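/- Let $(\Omega,\mathcal F,\mu)$ be a probability space, $\mathcal H$ a complex Hilbert space, and $L_p(\mu,\mathcal H)$ the Bochner $L_p$-space. A *weight* is a nondecreasing real sequence $(G_n)_{n\ge1}$ with $G_1\ge1$ and $G_n\to\infty$. For $p>1$ and a weight $(G_n)$, let $\mathcal W_p(G_n)$ be the set of all weights $(W_n)$ for which there is a strictly increasing sequence of positive integers $(m_k)_{k\ge1}$ with $$\sum_{k\ge1}\Big(\frac{G_{m_k}}{W_{m_k}}\Big)^p<\infty\quad\text{and}\quad \sum_{k\ge1}\Big(\frac{m_{k+1}-m_k}{W_{m_k}}\Big)^p<\infty .$$ **Theorem 4.4.** Let $(G_n)$ be a weight, $(n_k)_{k\ge1}$ a (not necessarily strictly) increasing sequence of nonnegative integers and $(a_k)_{k\ge1}$ a bounded sequence of complex numbers such that $$\sup_{n\ge1}\max_{|\lambda|=1}\Big|\frac1{G_n}\sum_{k=1}^n a_k\lambda^{n_k}\Big|<\infty .$$ (i) For every linear contraction $T$ of $L_2(\mu,\mathcal H)$, every $f\in L_2(\mu,\mathcal H)$ and every $(W_n)\in\mathcal W_2(G_n)$ with $\sum_{n\ge1}\frac{G_n}{W_n}\big(1-\frac{W_n}{W_{n+1}}\big)<\infty$,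 the series $\sum_{k\ge1}\frac{a_kT^{n_k}f}{W_k}$ converges a.e. in the norm of $\mathcal H$, and $$\sup_{n\ge1}\Big\|\sum_{k=1}^n\frac{a_kT^{n_k}f}{W_k}\Big\|_{\mathcal H}\in L_2(\mu).$$ (ii) Let $1<p<2$ and $G_n^{(p)}=G_n^{2(p-1)/p}\,n^{(2-p)/p}$. For every Dunford–Schwartz operator $T$ (a linear contraction of $L_1(\mu,\mathcal H)$ with $\|Tg\|_\infty\le\|g\|_\infty$ for all $g\in L_1\cap L_\infty$), every $f\in L_p(\mu,\mathcal H)$ and every $(\tilde W_n)\in\mathcal W_p(G_n^{(p)})$ with $\sum_{n\ge1}\frac{G_n^{(p)}}{\tilde W_n}\big(1-\frac{\tilde W_n}{\tilde W_{n+1}}\big)<\infty$, the series $\sum_{k\ge1}\frac{a_kT^{n_k}f}{\tilde W_k}$ converges a.e. in the norm of $\mathcal H$, and $$\sup_{n\ge1}\Big\|\sum_{k=1}^n\frac{a_kT^{n_k}f}{\tilde W_k}\Big\|_{\mathcal H}\in L_p(\mu).$$ -/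

import Mathlib

open MeasureTheory Filter Topology
open scoped ENNReal

namespace ErgodicHilbert

/-- A weight: a nondecreasing sequence `G 1 ≤ G 2 ≤ ⋯` of reals with `G 1 ≥ 1` and `G n → ∞`.
Sequences are indexed by `n ≥ 1`; the value at `0` plays no role. -/
def IsWeight (G : ℕ → ℝ) : Prop :=
  MonotoneOn G (Set.Ici 1) ∧ 1 ≤ G 1 ∧ Tendsto G atTop atTop

/-- The set of all weights that are `p`-admissible with respect to `G`. -/
def Admissible (p : ℝ) (G : ℕ → ℝ) : Set (ℕ → ℝ) :=
  {W | IsWeight W ∧ ∃ m : ℕ → ℕ, StrictMono m ∧ (∀ k, 1 ≤ m k) ∧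
    Summable (fun k => (G (m k) / W (m k)) ^ p) ∧
    Summable (fun k => (((m (k + 1) : ℝ) - (m k : ℝ)) / W (m k)) ^ p)}

/-- The condition `∑_{n ≥ 1} (G n / W n) (1 - W n / W (n + 1)) < ∞`
(for weights all the terms are nonnegative). -/
def SummableVariation (G W : ℕ → ℝ) : Prop :=
  Summable (fun n : ℕ => G (n + 1) / W (n + 1) * (1 - W (n + 1) / W (n + 2)))

/-- The sequence `G_n^{2(p-1)/p} n^{(2-p)/p}`. -/
noncomputable def interpWeight (p : ℝ) (G : ℕ → ℝ) (n : ℕ) : ℝ :=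
  G n ^ (2 * (p - 1) / p) * (n : ℝ) ^ ((2 - p) / p)

section

variable {Ω : Type*} [MeasurableSpace Ω] {H : Type*} [NormedAddCommGroup H]
  [InnerProductSpace ℂ H]

/-- A Dunford–Schwartz operator: a linear contraction of `L_1(μ, H)` with
`‖T f‖_∞ ≤ ‖f‖_∞` for all `f ∈ L_1 ∩ L_∞`. -/
def IsDunfordSchwartz (μ : Measure Ω) (T : Lp H 1 μ →L[ℂ] Lp H 1 μ) : Prop :=
  ‖T‖ ≤ 1 ∧ ∀ f : Lp H 1 μ, MemLp f ∞ μ → eLpNorm (T f) ∞ μ ≤ eLpNorm f ∞ μ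

/-- The partial sum `∑_{k=1}^n a_k (T^{n_k} f)(x) / W_k` of the modulated one-sided ergodic
Hilbert transform, where `e k = n_k`. -/
noncomputable def hilbertSum {μ : Measure Ω} {q : ℝ≥0∞} [Fact (1 ≤ q)]
    (a : ℕ → ℂ) (e : ℕ → ℕ) (W : ℕ → ℝ) (T : Lp H q μ →L[ℂ] Lp H q μ) (f : Lp H q μ)
    (n : ℕ) (x : Ω) : H :=
  ∑ k ∈ Finset.Icc 1 n, (a k / (W k : ℂ)) • ((T ^ e k) f : Lp H q μ) x

end

end ErgodicHilbert

/-! Write `S_n` for the unweighted sum of `a_k T^{n_k} f`, `k ≤ n`. Everything follows from two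
bounds: the terms are bounded in `L_p`, and `‖S_n‖_p ≤ K' F_n`, where `F = G` for `p = 2` and `F =
interpWeight p G` for `1 < p < 2`.

For `p = 2` the second bound is von Neumann's inequality (`norm_sum_pow_le`) for the polynomial `∑
a_k z^{n_k}`. It is proved by modelling the contraction as a shift and diagonalising the shift on a
finite cyclic group. For `1 < p < 2`, `lintegral_rpow_le_of_interpolation` combines the trivial
`L_1` bound `C n` with the `L_2` bound `K G_n`; a real-variable proof by truncation suffices, as
constants are immaterial.

The passage to weighted sums is `ae_tendsto_and_memLp_iSup`. Abel summation gives `S_n / W_n` plus a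
series with terms `(1/W_i - 1/W_{i+1}) S_i`. The variation condition makes that series absolutely
convergent in `L_p`. The boundary term is controlled along `m_k` by an `ℓ_p` sum, and between `m_k`
and `m_{k+1}` by the triangle inequality. The `L_p` functions that dominate the partial sums are
a.e. finite, which also yields convergence, so no separate maximal ergodic theorem is needed. -/

namespace ErgodicHilbert

/-! ### Von Neumann's inequality via finite Fourier analysis -/

section VonNeumann

variable {E : Type*} [NormedAddCommGroup E] [InnerProductSpace ℂ E]

lemma sum_zmod_eq_sum_range {N : ℕ} [NeZero N] (F : ZMod N → ℝ) :
    ∑ n, F n = ∑ i ∈ Finset.range N, F (i : ZMod N) := by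
  refine Finset.sum_nbij' (fun n => n.val) (fun i => (i : ZMod N)) ?_ ?_ ?_ ?_ ?_
  · intro n _
    simpa using ZMod.val_lt n
  · simp
  · simp
  · intro i hi
    exact ZMod.val_cast_of_lt (by simpa using hi)
  · simp

/-- Parseval's identity for vector-valued functions on `ZMod N`. -/
theorem sum_norm_sq_stdAddChar {N : ℕ} [NeZero N] (v : ZMod N → E) :
    ∑ k, ‖∑ j, (ZMod.stdAddChar (j * k) : ℂ) • v j‖ ^ 2 = N * ∑ j, ‖v j‖ ^ 2 := by
  have key : ∀ k, ((‖∑ j, (ZMod.stdAddChar (j * k) : ℂ) • v j‖ ^ 2 : ℝ) : ℂ)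
      = ∑ j, ∑ i, (ZMod.stdAddChar (k * (i - j)) : ℂ) * inner ℂ (v j) (v i) := by
    intro k
    push_cast
    rw [← Complex.coe_algebraMap, ← inner_self_eq_norm_sq_to_K (𝕜 := ℂ), sum_inner]
    refine Finset.sum_congr rfl fun j _ => ?_
    rw [inner_sum]
    refine Finset.sum_congr rfl fun i _ => ?_
    rw [inner_smul_left, inner_smul_right, ← AddChar.map_neg_eq_conj, ← mul_assoc,
      ← AddChar.map_add_eq_mul]
    congr 2
    ring
  have : ((∑ k, ‖∑ j, (ZMod.stdAddChar (j * k) : ℂ) • v j‖ ^ 2 : ℝ) : ℂ)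
      = ((N * ∑ j, ‖v j‖ ^ 2 : ℝ) : ℂ) := by
    rw [Complex.ofReal_sum, Finset.sum_congr rfl fun k _ => key k, Finset.sum_comm]
    push_cast
    rw [Finset.mul_sum]
    refine Finset.sum_congr rfl fun j _ => ?_
    rw [Finset.sum_comm]
    simp_rw [← Finset.sum_mul, AddChar.sum_mulShift _ (ZMod.isPrimitive_stdAddChar N), sub_eq_zero]
    simp only [Nat.cast_ite, Nat.cast_zero, ite_mul, zero_mul, Finset.sum_ite_eq',
      Finset.mem_univ, if_true, ZMod.card]
    rw [inner_self_eq_norm_sq_to_K]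
    simp
  exact_mod_cast this

/-- A trigonometric polynomial bounded by `S` on the unit circle acts on functions on `ZMod N`,
through the cyclic shift, with `ℓ²`-norm at most `S`. -/
theorem sum_norm_sq_cyclic_le {N : ℕ} [NeZero N] {ι : Type*} (s : Finset ι) (a : ι → ℂ) (e : ι → ℕ)
    {S : ℝ} (hS : ∀ z : ℂ, ‖z‖ = 1 → ‖∑ i ∈ s, a i * z ^ e i‖ ≤ S) (v : ZMod N → E) :
    ∑ n, ‖∑ i ∈ s, a i • v (n + e i)‖ ^ 2 ≤ S ^ 2 * ∑ n, ‖v n‖ ^ 2 := by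
  have hN : (0 : ℝ) < N := Nat.cast_pos.2 (Nat.pos_of_ne_zero (NeZero.ne N))
  refine le_of_mul_le_mul_left ?_ hN
  rw [← sum_norm_sq_stdAddChar, mul_left_comm, ← sum_norm_sq_stdAddChar, Finset.mul_sum]
  refine Finset.sum_le_sum fun k _ => ?_
  -- The Fourier transform diagonalises the shift: translating `j` by `e i` costs the factor
  -- `stdAddChar (-k) ^ e i`, so the polynomial is evaluated at a point of the unit circle.
  have h1 : ∑ j, (ZMod.stdAddChar (j * k) : ℂ) • ∑ i ∈ s, a i • v (j + e i)
      = (∑ i ∈ s, a i * (ZMod.stdAddChar (-k) : ℂ) ^ e i) •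
        ∑ j, (ZMod.stdAddChar (j * k) : ℂ) • v j := by
    simp_rw [Finset.smul_sum]
    rw [Finset.sum_comm]
    simp_rw [Finset.sum_smul]
    rw [Finset.sum_comm (s := Finset.univ)]
    refine Finset.sum_congr rfl fun i _ => ?_
    rw [← Equiv.sum_comp (Equiv.addRight (e i : ZMod N))
      (fun j => (a i * (ZMod.stdAddChar (-k) : ℂ) ^ e i) • (ZMod.stdAddChar (j * k) : ℂ) • v j)]
    refine Finset.sum_congr rfl fun j _ => ?_
    rw [Equiv.coe_addRight, smul_smul, smul_smul, mul_comm, mul_assoc, ← AddChar.map_nsmul_eq_pow,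
      ← AddChar.map_add_eq_mul]
    congr 3
    rw [nsmul_eq_mul]
    ring
  rw [h1, norm_smul, mul_pow]
  refine mul_le_mul_of_nonneg_right ?_ (by positivity)
  exact pow_le_pow_left₀ (norm_nonneg _) (hS _ (AddChar.norm_apply _ _)) 2

variable [CompleteSpace E]

/-- Contractivity makes `1 - T*T` positive, so it factors as `D*D` in the C*-algebra of operators.
-/
lemma exists_defect (T : E →L[ℂ] E) (hT : ‖T‖ ≤ 1) :
    ∃ D : E →L[ℂ] E, ∀ x, ‖D x‖ ^ 2 = ‖x‖ ^ 2 - ‖T x‖ ^ 2 := by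
  have inner_eq : ∀ x, inner ℂ ((1 - star T * T) x) x = ((‖x‖ ^ 2 - ‖T x‖ ^ 2 : ℝ) : ℂ) := by
    intro x
    simp [ContinuousLinearMap.star_eq_adjoint, ContinuousLinearMap.adjoint_inner_left]
  have h : 0 ≤ 1 - star T * T := by
    rw [ContinuousLinearMap.nonneg_iff_isPositive, ContinuousLinearMap.isPositive_iff_complex]
    intro x
    rw [inner_eq]
    refine ⟨by rw [RCLike.re_to_complex, Complex.ofReal_re], ?_⟩
    have := (T.le_opNorm x).trans (mul_le_of_le_one_left (norm_nonneg x) hT)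
    rw [RCLike.re_to_complex, Complex.ofReal_re, sub_nonneg]
    gcongr
  obtain ⟨D, hD⟩ := CStarAlgebra.nonneg_iff_eq_star_mul_self.1 h
  refine ⟨D, fun x => ?_⟩
  have := inner_eq x
  rw [hD, ContinuousLinearMap.star_eq_adjoint, mul_apply_eq_comp,
    ContinuousLinearMap.adjoint_inner_left, inner_self_eq_norm_sq_to_K] at this
  refine Complex.ofReal_injective (Eq.trans ?_ this)
  exact Complex.ofReal_pow _ _

/-- The sequence `(D T^i y)_i` has squared `ℓ²`-norm `‖y‖²`: the defect identity telescopes and `T^L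
y → 0` because `‖T‖ < 1`. Under this isometry `T` becomes the left shift, to which the cyclic
estimate applies after cutting to finite length. -/
theorem norm_sum_pow_le_of_norm_lt_one {ι : Type*} (s : Finset ι) (a : ι → ℂ) (e : ι → ℕ)
    {S : ℝ} (hS : ∀ z : ℂ, ‖z‖ = 1 → ‖∑ i ∈ s, a i * z ^ e i‖ ≤ S)
    (T : E →L[ℂ] E) (hT : ‖T‖ < 1) (x : E) :
    ‖∑ i ∈ s, a i • (T ^ e i) x‖ ≤ S * ‖x‖ := by
  obtain ⟨D, hD⟩ := exists_defect T hT.le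
  have tele : ∀ (y : E) (L : ℕ),
      ∑ i ∈ Finset.range L, ‖D ((T ^ i) y)‖ ^ 2 = ‖y‖ ^ 2 - ‖(T ^ L) y‖ ^ 2 := by
    intro y L
    simp_rw [hD]
    have := Finset.sum_range_sub' (fun i => ‖(T ^ i) y‖ ^ 2) L
    simpa [pow_succ'] using this
  have hS0 : 0 ≤ S := (norm_nonneg _).trans (hS 1 (by simp))
  set y := ∑ i ∈ s, a i • (T ^ e i) x with hy
  set d := s.sup e
  have main : ∀ L : ℕ, ‖y‖ ^ 2 - ‖(T ^ L) y‖ ^ 2 ≤ S ^ 2 * ‖x‖ ^ 2 := by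
    intro L
    have : NeZero (L + d) ∨ L = 0 := by
      rcases Nat.eq_zero_or_pos L with h | h
      · exact Or.inr h
      · exact Or.inl ⟨by omega⟩
    rcases this with hne | rfl
    swap
    · simp; positivity
    -- Padding the cycle by the largest exponent `d` prevents wrap-around: `n + e i < L + d`
    -- whenever `n < L`. The indices `n ≥ L` are discarded from the left-hand sum.
    have h1 := sum_norm_sq_cyclic_le (N := L + d) s a e hS (fun n => D ((T ^ n.val) x))
    rw [sum_zmod_eq_sum_range, sum_zmod_eq_sum_range (fun n => ‖D ((T ^ n.val) x)‖ ^ 2)] at h1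
    rw [← tele]
    calc _ ≤ _ := ?_
      _ ≤ _ := h1
      _ ≤ _ := ?_
    · refine (Finset.sum_le_sum_of_subset_of_nonneg (Finset.range_mono (Nat.le_add_right L d))
        fun _ _ _ => by positivity).trans' (le_of_eq ?_)
      refine Finset.sum_congr rfl fun n hn => ?_
      have hn' := Finset.mem_range.1 hn
      rw [hy, map_sum, map_sum]
      congr 2
      refine Finset.sum_congr rfl fun i hi => ?_
      have hi' : e i ≤ d := Finset.le_sup hi
      have : ((n : ZMod (L + d)) + (e i : ZMod (L + d))).val = n + e i := by
        rw [← Nat.cast_add]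
        exact ZMod.val_cast_of_lt (by omega)
      rw [this, map_smul, map_smul, pow_add]
      rfl
    · refine mul_le_mul_of_nonneg_left ?_ (by positivity)
      have : ∀ i ∈ Finset.range (L + d), ‖D ((T ^ (i : ZMod (L + d)).val) x)‖ ^ 2
          = ‖D ((T ^ i) x)‖ ^ 2 := fun i hi => by
        rw [ZMod.val_cast_of_lt (Finset.mem_range.1 hi)]
      rw [Finset.sum_congr rfl this, tele]
      linarith [sq_nonneg ‖(T ^ (L + d)) x‖]
  have hlim : Tendsto (fun L : ℕ => ‖y‖ ^ 2 - ‖(T ^ L) y‖ ^ 2) atTop (𝓝 (‖y‖ ^ 2 - 0 ^ 2)) := by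
    refine tendsto_const_nhds.sub (Tendsto.pow ?_ 2)
    refine squeeze_zero (fun _ => norm_nonneg _) (g := fun L => ‖T‖ ^ L * ‖y‖) (fun L => ?_) ?_
    · induction L with
      | zero => simp
      | succ L ih =>
        rw [pow_succ', pow_succ', mul_assoc]
        exact (T.le_opNorm _).trans (mul_le_mul_of_nonneg_left ih (norm_nonneg T))
    · simpa using (tendsto_pow_atTop_nhds_zero_of_lt_one (norm_nonneg T) hT).mul_const ‖y‖
  have h2 := le_of_tendsto' hlim main
  refine abs_le_of_sq_le_sq' ?_ (by positivity) |>.2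
  rw [mul_pow]
  linarith

/-- von Neumann's inequality. -/
theorem norm_sum_pow_le {ι : Type*} (s : Finset ι) (a : ι → ℂ) (e : ι → ℕ)
    {S : ℝ} (hS : ∀ z : ℂ, ‖z‖ = 1 → ‖∑ i ∈ s, a i * z ^ e i‖ ≤ S)
    (T : E →L[ℂ] E) (hT : ‖T‖ ≤ 1) (x : E) :
    ‖∑ i ∈ s, a i • (T ^ e i) x‖ ≤ S * ‖x‖ := by
  -- The strict case applies to `r T` with `0 < r < 1`; then `r` tends to `1`.
  have hcont : Continuous fun r : ℝ => ‖∑ i ∈ s, a i • (((r : ℂ) • T) ^ e i) x‖ := by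
    simp_rw [smul_pow, smul_apply]
    fun_prop
  have hlim : Tendsto (fun r : ℝ => ‖∑ i ∈ s, a i • (((r : ℂ) • T) ^ e i) x‖) (𝓝[<] 1)
      (𝓝 ‖∑ i ∈ s, a i • (T ^ e i) x‖) := by
    have := (hcont.tendsto 1).mono_left (nhdsWithin_le_nhds (s := Set.Iio 1))
    simpa using this
  refine le_of_tendsto hlim ?_
  filter_upwards [Ioo_mem_nhdsLT (zero_lt_one' ℝ)] with r hr
  refine norm_sum_pow_le_of_norm_lt_one s a e hS _ ?_ x
  rw [norm_smul, Complex.norm_real, Real.norm_of_nonneg hr.1.le]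
  nlinarith [hr.1, hr.2, norm_nonneg T]

end VonNeumann

/-! ### Powers as mixtures of truncated functions -/

section LayerCake

lemma lintegral_Ioi_scale {u : ℝ} (hu : 0 < u) (F : ℝ → ℝ≥0∞) :
    ∫⁻ t in Set.Ioi 0, F t = ENNReal.ofReal u * ∫⁻ r in Set.Ioi 0, F (u * r) := by
  have h1 := (Homeomorph.mulLeft₀ u hu.ne').toMeasurableEquiv.measurableEmbedding
  have h2 : (Homeomorph.mulLeft₀ u hu.ne') ⁻¹' Set.Ioi 0 = Set.Ioi 0 := by
    ext r
    simp [hu]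
  have h3 : ∫⁻ t in Set.Ioi 0, F t ∂(Measure.map (Homeomorph.mulLeft₀ u hu.ne').toMeasurableEquiv
      volume) = ∫⁻ r in Set.Ioi 0, F (u * r) := by
    rw [h1.restrict_map, h1.lintegral_map]
    change ∫⁻ r in (Homeomorph.mulLeft₀ u hu.ne') ⁻¹' Set.Ioi 0, F (u * r) = _
    rw [h2]
  have h4 : Measure.map (Homeomorph.mulLeft₀ u hu.ne').toMeasurableEquiv volume
      = ENNReal.ofReal |u⁻¹| • (volume : Measure ℝ) := Real.map_volume_mul_left hu.ne'
  rw [h4, Measure.restrict_smul, lintegral_smul_measure, abs_of_pos (inv_pos.2 hu)] at h3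
  rw [← h3, smul_eq_mul, ← mul_assoc, ← ENNReal.ofReal_mul hu.le, mul_inv_cancel₀ hu.ne',
    ENNReal.ofReal_one, one_mul]

lemma setLIntegral_Ioi_ne_zero {F : ℝ → ℝ} (hF : Measurable F)
    (hpos : ∀ r ∈ Set.Ioo (0 : ℝ) 1, 0 < F r) :
    ∫⁻ r in Set.Ioi 0, ENNReal.ofReal (F r) ≠ 0 := by
  intro h
  rw [lintegral_eq_zero_iff hF.ennreal_ofReal, Filter.EventuallyEq,
    ae_restrict_iff' measurableSet_Ioi] at h
  have h1 : volume (Set.Ioo (0 : ℝ) 1) = 0 := by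
    refine measure_mono_null (fun r hr => ?_) h
    simpa [hr.1] using hpos r hr
  simp at h1

/-- The power `u ^ p` as a mixture of the functions `u ↦ (u - t)₊`. -/
lemma exists_lintegral_posPart_sub {p : ℝ} (hp : 1 < p) :
    ∃ κ : ℝ≥0∞, κ ≠ 0 ∧ κ ≠ ∞ ∧ ∀ u : ℝ, 0 ≤ u →
      ∫⁻ t in Set.Ioi 0, ENNReal.ofReal (t ^ (p - 2) * max (u - t) 0)
        = ENNReal.ofReal (u ^ p) * κ := by
  refine ⟨∫⁻ r in Set.Ioi 0, ENNReal.ofReal (r ^ (p - 2) * max (1 - r) 0), ?_, ?_, ?_⟩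
  · refine setLIntegral_Ioi_ne_zero (by fun_prop) fun r hr => ?_
    exact mul_pos (Real.rpow_pos_of_pos hr.1 _) (lt_max_of_lt_left (sub_pos.2 hr.2))
  -- The integrand vanishes beyond `1` and is at most `r ^ (p - 2)` below it, integrable at `0`
  -- since `p > 1`.
  · have h1 : IntegrableOn (fun r : ℝ => r ^ (p - 2)) (Set.Ioc 0 1) := by
      rw [← intervalIntegrable_iff_integrableOn_Ioc_of_le zero_le_one]
      exact intervalIntegral.intervalIntegrable_rpow' (by linarith)
    have h2 := h1.2
    rw [hasFiniteIntegral_iff_enorm] at h2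
    refine (lt_of_le_of_lt ?_ h2).ne
    rw [← lintegral_indicator measurableSet_Ioi, ← lintegral_indicator measurableSet_Ioc]
    refine lintegral_mono fun r => ?_
    rw [Set.indicator_apply, Set.indicator_apply]
    split_ifs with h3 h4 h4
    · have h3' : 0 < r := h3
      rw [← ofReal_norm, Real.norm_of_nonneg (by positivity)]
      refine ENNReal.ofReal_le_ofReal (mul_le_of_le_one_right (by positivity) ?_)
      exact max_le (by linarith) zero_le_one
    · have : 1 < r := by
        by_contra h
        exact h4 ⟨h3, not_lt.1 h⟩
      rw [max_eq_right (by linarith)]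
      simp
    · simp
    · simp
  · intro u hu
    rcases hu.eq_or_lt with rfl | hu
    · rw [Real.zero_rpow (by linarith), ENNReal.ofReal_zero, zero_mul]
      refine (setLIntegral_congr_fun measurableSet_Ioi fun t ht => ?_).trans lintegral_zero
      have ht' : (0 : ℝ) < t := ht
      simp [ht'.le]
    · rw [lintegral_Ioi_scale hu, ← lintegral_const_mul' _ _ ENNReal.ofReal_ne_top,
        ← lintegral_const_mul' _ _ ENNReal.ofReal_ne_top]
      refine setLIntegral_congr_fun measurableSet_Ioi fun r hr => ?_
      have hr' : (0 : ℝ) < r := hr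
      have h1 : u ^ p = u * (u ^ (p - 2) * u) := by
        rw [mul_comm, mul_assoc, ← sq, ← Real.rpow_natCast, ← Real.rpow_add hu]
        norm_num
      have h2 : max (u - u * r) 0 = u * max (1 - r) 0 := by
        rw [mul_max_of_nonneg _ _ hu.le]
        congr 1 <;> ring
      rw [← ENNReal.ofReal_mul hu.le, ← ENNReal.ofReal_mul (by positivity), h1, h2,
        Real.mul_rpow hu.le hr'.le]
      congr 1
      ring

/-- The power `u ^ p`, `1 < p < 2`, as a mixture of the functions `u ↦ min (u²) (t u)`. -/
lemma exists_lintegral_min_sq {p : ℝ} (hp : 1 < p) (hp2 : p < 2) :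
    ∃ κ : ℝ≥0∞, κ ≠ 0 ∧ κ ≠ ∞ ∧ ∀ c u : ℝ, 0 < c → 0 ≤ u →
      ∫⁻ t in Set.Ioi 0, ENNReal.ofReal (t ^ (p - 3) * min (u ^ 2) (c * t * u))
        = ENNReal.ofReal (c ^ (2 - p)) * (ENNReal.ofReal (u ^ p) * κ) := by
  refine ⟨∫⁻ r in Set.Ioi 0, ENNReal.ofReal (r ^ (p - 3) * min 1 r), ?_, ?_, ?_⟩
  · refine setLIntegral_Ioi_ne_zero (by fun_prop) fun r hr => ?_
    exact mul_pos (Real.rpow_pos_of_pos hr.1 _) (lt_min one_pos hr.1)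
  -- The integrand is `r ^ (p - 2)` near `0` and `r ^ (p - 3)` near infinity; convergence at the two
  -- ends uses `p > 1` and `p < 2` respectively.
  · have h1 : IntegrableOn (fun r : ℝ => r ^ (p - 2)) (Set.Ioc 0 1) := by
      rw [← intervalIntegrable_iff_integrableOn_Ioc_of_le zero_le_one]
      exact intervalIntegral.intervalIntegrable_rpow' (by linarith)
    have h2 := integrableOn_Ioi_rpow_of_lt (a := p - 3) (by linarith) one_pos
    have h1' := h1.2
    have h2' := h2.2
    rw [hasFiniteIntegral_iff_enorm] at h1' h2'
    rw [← Set.Ioc_union_Ioi_eq_Ioi (zero_le_one' ℝ)]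
    refine ((lintegral_union_le _ _ _).trans_lt (ENNReal.add_lt_top.2
      ⟨lt_of_le_of_lt ?_ h1', lt_of_le_of_lt ?_ h2'⟩)).ne
    · refine setLIntegral_mono' measurableSet_Ioc fun r hr => ?_
      have h0 : 0 < r := hr.1
      rw [← ofReal_norm, Real.norm_of_nonneg (by positivity)]
      refine ENNReal.ofReal_le_ofReal ?_
      calc r ^ (p - 3) * min 1 r ≤ r ^ (p - 3) * r := by gcongr; exact min_le_right _ _
        _ = r ^ (p - 3) * r ^ (1 : ℝ) := by rw [Real.rpow_one]
        _ = r ^ (p - 2) := by rw [← Real.rpow_add h0]; ring_nf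
    · refine setLIntegral_mono' measurableSet_Ioi fun r hr => ?_
      have h0 : 0 < r := zero_lt_one.trans hr
      rw [← ofReal_norm, Real.norm_of_nonneg (by positivity)]
      refine ENNReal.ofReal_le_ofReal (mul_le_of_le_one_right (by positivity) (min_le_left _ _))
  · intro c u hc hu
    rcases hu.eq_or_lt with rfl | hu
    · rw [Real.zero_rpow (by linarith), ENNReal.ofReal_zero, zero_mul, mul_zero]
      simp
    · rw [lintegral_Ioi_scale (div_pos hu hc), ← lintegral_const_mul' _ _ ENNReal.ofReal_ne_top,
        ← lintegral_const_mul' _ _ ENNReal.ofReal_ne_top,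
        ← lintegral_const_mul' _ _ ENNReal.ofReal_ne_top]
      refine setLIntegral_congr_fun measurableSet_Ioi fun r hr => ?_
      have hr' : (0 : ℝ) < r := hr
      have h1 : u ^ p = u ^ (p - 3) * u ^ 3 := by
        rw [← Real.rpow_natCast u 3, ← Real.rpow_add hu]
        norm_num
      have h3 : c ^ (2 - p) = (c ^ (p - 3))⁻¹ * c⁻¹ := by
        rw [← Real.rpow_neg hc.le, ← Real.rpow_neg_one, ← Real.rpow_add hc]
        ring_nf
      have h2 : min (u ^ 2) (c * (u / c * r) * u) = u ^ 2 * min 1 r := by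
        rw [mul_min_of_nonneg _ _ (by positivity)]
        congr 1
        · ring
        · field_simp
      rw [← ENNReal.ofReal_mul (by positivity), ← ENNReal.ofReal_mul (by positivity),
        ← ENNReal.ofReal_mul (by positivity), h1, h2, h3, Real.mul_rpow (by positivity) hr'.le,
        Real.div_rpow hu.le hc.le]
      congr 1
      field_simp

variable {Ω : Type*} [MeasurableSpace Ω] {μ : Measure Ω} [SFinite μ]
  {H : Type*} [NormedAddCommGroup H]

/-- By Tonelli, an estimate at every truncation level `t` may be integrated over `t`; with the
mixtures above this yields `L_p` estimates. -/
lemma lintegral_lintegral_le_of_forall {K₁ K₂ : ℝ → ℝ → ℝ≥0∞}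
    (hK₁ : Measurable (Function.uncurry K₁)) (hK₂ : Measurable (Function.uncurry K₂))
    {f g : Ω → H} (hf : StronglyMeasurable f) (hg : StronglyMeasurable g)
    (h : ∀ t, 0 < t → ∫⁻ x, K₁ t ‖g x‖ ∂μ ≤ ∫⁻ x, K₂ t ‖f x‖ ∂μ) :
    ∫⁻ x, (∫⁻ t in Set.Ioi 0, K₁ t ‖g x‖) ∂μ ≤ ∫⁻ x, (∫⁻ t in Set.Ioi 0, K₂ t ‖f x‖) ∂μ := by
  have hfn := hf.norm.measurable
  have hgn := hg.norm.measurable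
  rw [lintegral_lintegral_swap (f := fun x t => K₁ t ‖g x‖),
    lintegral_lintegral_swap (f := fun x t => K₂ t ‖f x‖)]
  · exact setLIntegral_mono' measurableSet_Ioi h
  · exact (hK₂.comp (measurable_snd.prodMk (hfn.comp measurable_fst))).aemeasurable
  · exact (hK₁.comp (measurable_snd.prodMk (hgn.comp measurable_fst))).aemeasurable

end LayerCake

/-! ### Truncation, contractivity on `L_p`, and interpolation -/

section Truncation

variable {Ω : Type*} [MeasurableSpace Ω] {μ : Measure Ω}
  {H : Type*} [NormedAddCommGroup H] [InnerProductSpace ℂ H]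

/-- Radial truncation of a vector to norm at most `t`. -/
noncomputable def trunc (t : ℝ) (v : H) : H := ((min 1 (t / ‖v‖) : ℝ) : ℂ) • v

lemma norm_trunc {t : ℝ} (ht : 0 < t) (v : H) : ‖trunc t v‖ = min ‖v‖ t := by
  rw [trunc, norm_smul, Complex.norm_real, Real.norm_of_nonneg (by positivity)]
  rcases eq_or_ne v 0 with rfl | hv
  · simp [ht.le]
  · have hv' := norm_pos_iff.2 hv
    rw [min_mul_of_nonneg _ _ hv'.le, one_mul, div_mul_cancel₀ _ hv'.ne']

lemma norm_sub_trunc {t : ℝ} (ht : 0 < t) (v : H) : ‖v - trunc t v‖ = max (‖v‖ - t) 0 := by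
  have h : v - trunc t v = ((1 - min 1 (t / ‖v‖) : ℝ) : ℂ) • v := by
    rw [trunc, Complex.ofReal_sub, sub_smul, Complex.ofReal_one, one_smul]
  rw [h, norm_smul, Complex.norm_real, Real.norm_of_nonneg (sub_nonneg.2 (min_le_left _ _))]
  rcases eq_or_ne v 0 with rfl | hv
  · simp [ht.le]
  · have hv' := norm_pos_iff.2 hv
    rw [sub_mul, min_mul_of_nonneg _ _ hv'.le, one_mul, div_mul_cancel₀ _ hv'.ne']
    rcases le_total ‖v‖ t with h | h
    · rw [min_eq_left h, max_eq_right (by linarith)]; simp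
    · rw [min_eq_right h, max_eq_left (by linarith)]

lemma aestronglyMeasurable_trunc (t : ℝ) {f : Ω → H} (hf : AEStronglyMeasurable f μ) :
    AEStronglyMeasurable (fun x => trunc t (f x)) μ := by
  have h : AEMeasurable (fun x => ((min 1 (t / ‖f x‖) : ℝ) : ℂ)) μ := by
    have := hf.norm.aemeasurable
    fun_prop
  exact h.aestronglyMeasurable.smul hf

lemma memLp_trunc {t : ℝ} (ht : 0 < t) {f : Ω → H} {q : ℝ≥0∞} (hf : MemLp f q μ) :
    MemLp (fun x => trunc t (f x)) q μ :=
  hf.of_le (aestronglyMeasurable_trunc t hf.1)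
    (ae_of_all _ fun x => (norm_trunc ht (f x)).trans_le (min_le_left _ _))

lemma lintegral_enorm_eq_ofReal_norm {E : Type*} [NormedAddCommGroup E] (f : Lp E 1 μ) : ∫⁻ x, ‖f x‖ₑ ∂μ = ENNReal.ofReal ‖f‖ := by
  rw [← eLpNorm_one_eq_lintegral_enorm, Lp.norm_def, ENNReal.ofReal_toReal (Lp.eLpNorm_ne_top f)]

lemma lintegral_enorm_le_of_opNorm_le {A : ℝ} (hA : 0 ≤ A) (S : Lp H 1 μ →L[ℂ] Lp H 1 μ)
    (hS : ‖S‖ ≤ A) (f : Lp H 1 μ) :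
    ∫⁻ x, ‖S f x‖ₑ ∂μ ≤ ENNReal.ofReal A * ∫⁻ x, ‖f x‖ₑ ∂μ := by
  rw [lintegral_enorm_eq_ofReal_norm, lintegral_enorm_eq_ofReal_norm, ← ENNReal.ofReal_mul hA]
  exact ENNReal.ofReal_le_ofReal (S.le_of_opNorm_le hS f)

/-- Splitting of an integrable function into a bounded part and the excess over level `t`. -/
lemma exists_split {t : ℝ} (ht : 0 < t) (f : Lp H 1 μ) :
    ∃ f₁ f₂ : Lp H 1 μ, f = f₁ + f₂ ∧ (∀ᵐ x ∂μ, ‖f₁ x‖ = min ‖f x‖ t) ∧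
      ∀ᵐ x ∂μ, ‖f₂ x‖ = max (‖f x‖ - t) 0 := by
  have h := memLp_trunc ht (Lp.memLp f)
  refine ⟨h.toLp _, f - h.toLp _, by simp, ?_, ?_⟩
  · filter_upwards [h.coeFn_toLp] with x hx
    rw [hx, norm_trunc ht]
  · filter_upwards [h.coeFn_toLp, Lp.coeFn_sub f (h.toLp _)] with x hx hx'
    rw [hx', Pi.sub_apply, hx, norm_sub_trunc ht]

lemma ae_norm_le_of_isDunfordSchwartz {T : Lp H 1 μ →L[ℂ] Lp H 1 μ} (hT : IsDunfordSchwartz μ T)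
    {t : ℝ} {f : Lp H 1 μ} (hf : ∀ᵐ x ∂μ, ‖f x‖ ≤ t) : ∀ᵐ x ∂μ, ‖T f x‖ ≤ t := by
  have h1 : MemLp f ∞ μ := memLp_top_of_bound (Lp.aestronglyMeasurable f) t hf
  have h2 : eLpNorm (T f) ∞ μ ≤ ENNReal.ofReal t := by
    refine (hT.2 f h1).trans ?_
    rw [eLpNorm_exponent_top]
    refine eLpNormEssSup_le_of_ae_bound hf
  rcases lt_or_ge t 0 with ht | ht
  · filter_upwards [hf] with x hx
    exact absurd (norm_nonneg (f x)) (by linarith)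
  rw [eLpNorm_exponent_top] at h2
  filter_upwards [enorm_ae_le_eLpNormEssSup (T f) μ] with x hx
  have := hx.trans h2
  rwa [← ofReal_norm, ENNReal.ofReal_le_ofReal_iff ht] at this

/-- Cut `f` at height `t`. The image of the bounded part stays below `t`, so the excess of `T f`
over `t` is dominated by the image of the excess part, where `T` contracts `L_1`. -/
lemma lintegral_posPart_sub_le_of_isDunfordSchwartz {T : Lp H 1 μ →L[ℂ] Lp H 1 μ}
    (hT : IsDunfordSchwartz μ T) (f : Lp H 1 μ) {t : ℝ} (ht : 0 < t) :
    ∫⁻ x, ENNReal.ofReal (max (‖T f x‖ - t) 0) ∂μ ≤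
      ∫⁻ x, ENNReal.ofReal (max (‖f x‖ - t) 0) ∂μ := by
  obtain ⟨f₁, f₂, rfl, h1, h2⟩ := exists_split ht f
  have h3 : ∀ᵐ x ∂μ, ‖f₁ x‖ ≤ t := h1.mono fun x hx => hx.trans_le (min_le_right _ _)
  calc _ ≤ ∫⁻ x, ‖T f₂ x‖ₑ ∂μ := by
        refine lintegral_mono_ae ?_
        rw [map_add]
        filter_upwards [ae_norm_le_of_isDunfordSchwartz hT h3, Lp.coeFn_add (T f₁) (T f₂)]
          with x hx hx'
        rw [← ofReal_norm, hx', Pi.add_apply]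
        refine ENNReal.ofReal_le_ofReal (max_le ?_ (norm_nonneg _))
        linarith [norm_add_le (T f₁ x) (T f₂ x)]
    _ ≤ ENNReal.ofReal 1 * ∫⁻ x, ‖f₂ x‖ₑ ∂μ :=
        lintegral_enorm_le_of_opNorm_le zero_le_one T hT.1 f₂
    _ = _ := by
        rw [ENNReal.ofReal_one, one_mul]
        refine lintegral_congr_ae ?_
        filter_upwards [h2] with x hx
        rw [← ofReal_norm, hx]

/-- A Dunford–Schwartz operator contracts every `L_p`-norm. -/
theorem lintegral_rpow_le_of_isDunfordSchwartz [SFinite μ] {T : Lp H 1 μ →L[ℂ] Lp H 1 μ}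
    (hT : IsDunfordSchwartz μ T) (f : Lp H 1 μ) {p : ℝ} (hp : 1 < p) :
    ∫⁻ x, ‖T f x‖ₑ ^ p ∂μ ≤ ∫⁻ x, ‖f x‖ₑ ^ p ∂μ := by
  obtain ⟨κ, hκ0, hκ, h⟩ := exists_lintegral_posPart_sub hp
  have hmeas : Measurable (Function.uncurry fun t u : ℝ =>
      ENNReal.ofReal (t ^ (p - 2) * max (u - t) 0)) := by
    unfold Function.uncurry
    fun_prop
  have key := lintegral_lintegral_le_of_forall (μ := μ) hmeas hmeas
    (Lp.stronglyMeasurable f) (Lp.stronglyMeasurable (T f)) fun t ht => by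
      simp_rw [ENNReal.ofReal_mul (Real.rpow_nonneg ht.le (p - 2))]
      rw [lintegral_const_mul' _ _ ENNReal.ofReal_ne_top,
        lintegral_const_mul' _ _ ENNReal.ofReal_ne_top]
      refine mul_le_mul' le_rfl ?_
      exact lintegral_posPart_sub_le_of_isDunfordSchwartz hT f ht
  simp_rw [h _ (norm_nonneg _)] at key
  rw [lintegral_mul_const' _ _ hκ, lintegral_mul_const' _ _ hκ,
    ENNReal.mul_le_mul_iff_left hκ0 hκ] at key
  simpa only [← ofReal_norm, ENNReal.ofReal_rpow_of_nonneg (norm_nonneg _)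
    (zero_le_one.trans hp.le)] using key

/-- Cut `f` at height `t`, using the `L_2` bound on the bounded part and the `L_1` bound on the
excess. Measuring `S f` at level `(B² / A) t` makes both contributions carry the same constant `4
B²`. -/
lemma lintegral_min_sq_le {A B : ℝ} (hA : 0 < A) (hB : 0 < B) (S : Lp H 1 μ →L[ℂ] Lp H 1 μ)
    (hSA : ‖S‖ ≤ A)
    (hSB : ∀ f : Lp H 1 μ, MemLp f ∞ μ →
      ∫⁻ x, ‖S f x‖ₑ ^ (2 : ℝ) ∂μ ≤ ENNReal.ofReal (B ^ 2) * ∫⁻ x, ‖f x‖ₑ ^ (2 : ℝ) ∂μ)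
    (f : Lp H 1 μ) {t : ℝ} (ht : 0 < t) :
    ∫⁻ x, ENNReal.ofReal (min (‖S f x‖ ^ 2) (B ^ 2 / A * t * ‖S f x‖)) ∂μ ≤
      ENNReal.ofReal (4 * B ^ 2) * ∫⁻ x, ENNReal.ofReal (min (‖f x‖ ^ 2) (1 * t * ‖f x‖)) ∂μ := by
  obtain ⟨f₁, f₂, hf, h1, h2⟩ := exists_split ht f
  have h3 : MemLp f₁ ∞ μ := memLp_top_of_bound (Lp.aestronglyMeasurable f₁) t
    (h1.mono fun x hx => hx.trans_le (min_le_right _ _))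
  set c := B ^ 2 / A with hc
  have hc0 : 0 < c := by positivity
  have sq_eq : ∀ v : H, ‖v‖ₑ ^ (2 : ℝ) = ENNReal.ofReal (‖v‖ ^ 2) := fun v => by
    rw [← ofReal_norm, ENNReal.ofReal_rpow_of_nonneg (norm_nonneg _) zero_le_two, Real.rpow_two]
  calc _ ≤ ∫⁻ x, (4 * ‖S f₁ x‖ₑ ^ (2 : ℝ) + ENNReal.ofReal (4 * c * t) * ‖S f₂ x‖ₑ) ∂μ := by
        refine lintegral_mono_ae ?_
        rw [hf, map_add]
        filter_upwards [Lp.coeFn_add (S f₁) (S f₂)] with x hx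
        rw [hx, Pi.add_apply, sq_eq, ← ofReal_norm, ← ENNReal.ofReal_mul (by positivity),
          show (4 : ℝ≥0∞) = ENNReal.ofReal 4 by simp, ← ENNReal.ofReal_mul (by positivity),
          ← ENNReal.ofReal_add (by positivity) (by positivity)]
        refine ENNReal.ofReal_le_ofReal ?_
        have h4 := norm_add_le (S f₁ x) (S f₂ x)
        have hct : 0 < c * t := by positivity
        set w := ‖S f₁ x + S f₂ x‖
        have hw : 0 ≤ w := norm_nonneg _
        set b₁ := ‖S f₁ x‖
        have hb₁ : 0 ≤ b₁ := norm_nonneg _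
        set b₂ := ‖S f₂ x‖
        have hb₂ : 0 ≤ b₂ := norm_nonneg _
        -- The norm `w` is at most twice the larger of `b₁`, `b₂`; the corresponding entry of the
        -- minimum is used, whence the factor `4`.
        rcases le_total b₂ b₁ with h | h
        · refine (min_le_left _ _).trans ?_
          have : 0 ≤ 4 * c * t * b₂ := by positivity
          nlinarith
        · refine (min_le_right _ _).trans ?_
          have : c * t * w ≤ c * t * (2 * b₂) := by gcongr; linarith
          nlinarith [mul_nonneg hct.le hb₂, sq_nonneg b₁]
    _ = 4 * ∫⁻ x, ‖S f₁ x‖ₑ ^ (2 : ℝ) ∂μ + ENNReal.ofReal (4 * c * t) * ∫⁻ x, ‖S f₂ x‖ₑ ∂μ := by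
        have m1 := (Lp.stronglyMeasurable (S f₁)).enorm
        rw [lintegral_add_left (by fun_prop), lintegral_const_mul' _ _ (by simp),
          lintegral_const_mul' _ _ ENNReal.ofReal_ne_top]
    _ ≤ 4 * (ENNReal.ofReal (B ^ 2) * ∫⁻ x, ‖f₁ x‖ₑ ^ (2 : ℝ) ∂μ)
        + ENNReal.ofReal (4 * c * t) * (ENNReal.ofReal A * ∫⁻ x, ‖f₂ x‖ₑ ∂μ) := by
        gcongr
        · exact hSB f₁ h3
        · exact lintegral_enorm_le_of_opNorm_le hA.le S hSA f₂
    _ = ENNReal.ofReal (4 * B ^ 2) * (∫⁻ x, ‖f₁ x‖ₑ ^ (2 : ℝ) ∂μ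
        + ENNReal.ofReal t * ∫⁻ x, ‖f₂ x‖ₑ ∂μ) := by
        have e1 : 4 * c * t * A = 4 * B ^ 2 * t := by rw [hc]; field_simp
        rw [← mul_assoc (ENNReal.ofReal (4 * c * t)), ← ENNReal.ofReal_mul (by positivity), e1,
          ENNReal.ofReal_mul (by positivity : 0 ≤ 4 * B ^ 2), mul_add,
          ENNReal.ofReal_mul (by norm_num : (0 : ℝ) ≤ 4)]
        simp only [ENNReal.ofReal_ofNat]
        ring
    _ = _ := by
        have m1 := (Lp.stronglyMeasurable f₁).enorm
        congr 1
        rw [← lintegral_const_mul' _ _ ENNReal.ofReal_ne_top, ← lintegral_add_left (by fun_prop)]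
        refine lintegral_congr_ae ?_
        filter_upwards [h1, h2] with x hx1 hx2
        rw [sq_eq, ← ofReal_norm, ← ENNReal.ofReal_mul ht.le,
          ← ENNReal.ofReal_add (by positivity) (by positivity), hx1, hx2]
        congr 1
        have hfx := norm_nonneg (f x)
        -- The identity is `min(u, t)² + t (u - t)₊ = min(u², t u)`.
        rcases le_total ‖f x‖ t with h | h
        · rw [min_eq_left h, max_eq_right (by linarith), min_eq_left (by nlinarith)]
          ring
        · rw [min_eq_right h, max_eq_left (by linarith), min_eq_right (by nlinarith)]
          ring

/-- Interpolation between `L_1` and `L_2`. -/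
theorem lintegral_rpow_le_of_interpolation [SFinite μ] {A B : ℝ} (hA : 0 < A) (hB : 0 < B)
    (S : Lp H 1 μ →L[ℂ] Lp H 1 μ) (hSA : ‖S‖ ≤ A)
    (hSB : ∀ f : Lp H 1 μ, MemLp f ∞ μ →
      ∫⁻ x, ‖S f x‖ₑ ^ (2 : ℝ) ∂μ ≤ ENNReal.ofReal (B ^ 2) * ∫⁻ x, ‖f x‖ₑ ^ (2 : ℝ) ∂μ)
    {p : ℝ} (hp : 1 < p) (hp2 : p < 2) (f : Lp H 1 μ) :
    ∫⁻ x, ‖S f x‖ₑ ^ p ∂μ ≤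
      ENNReal.ofReal (4 * (A ^ (2 - p) * B ^ (2 * (p - 1)))) * ∫⁻ x, ‖f x‖ₑ ^ p ∂μ := by
  obtain ⟨κ, hκ0, hκ, h⟩ := exists_lintegral_min_sq hp hp2
  set c := B ^ 2 / A with hc
  have hc0 : 0 < c := by positivity
  have hmeas₁ : Measurable (Function.uncurry fun t u : ℝ =>
      ENNReal.ofReal (t ^ (p - 3) * min (u ^ 2) (c * t * u))) := by
    unfold Function.uncurry
    fun_prop
  have hmeas₂ : Measurable (Function.uncurry fun t u : ℝ =>
      ENNReal.ofReal (4 * B ^ 2) * ENNReal.ofReal (t ^ (p - 3) * min (u ^ 2) (1 * t * u))) := by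
    unfold Function.uncurry
    fun_prop
  have key := lintegral_lintegral_le_of_forall (μ := μ) hmeas₁ hmeas₂
    (Lp.stronglyMeasurable f) (Lp.stronglyMeasurable (S f)) fun t ht => by
      simp_rw [ENNReal.ofReal_mul (Real.rpow_nonneg ht.le (p - 3)),
        mul_left_comm (ENNReal.ofReal (4 * B ^ 2))]
      rw [lintegral_const_mul' _ _ ENNReal.ofReal_ne_top,
        lintegral_const_mul' _ _ ENNReal.ofReal_ne_top,
        lintegral_const_mul' _ _ ENNReal.ofReal_ne_top]
      refine mul_le_mul' le_rfl ?_
      exact lintegral_min_sq_le hA hB S hSA hSB f ht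
  simp_rw [lintegral_const_mul' _ _ (ENNReal.ofReal_ne_top (r := 4 * B ^ 2)),
    h _ _ hc0 (norm_nonneg _), h _ _ one_pos (norm_nonneg _), Real.one_rpow, ENNReal.ofReal_one,
    one_mul] at key
  rw [lintegral_const_mul' _ _ ENNReal.ofReal_ne_top, lintegral_mul_const' _ _ hκ,
    lintegral_mul_const' _ _ hκ, ← mul_assoc,
    ← mul_assoc, ENNReal.mul_le_mul_iff_left hκ0 hκ] at key
  simp only [← ofReal_norm, ENNReal.ofReal_rpow_of_nonneg (norm_nonneg _)
    (zero_le_one.trans hp.le)]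
  have hcp : 0 < c ^ (2 - p) := by positivity
  have e1 : 4 * (A ^ (2 - p) * B ^ (2 * (p - 1))) = (c ^ (2 - p))⁻¹ * (4 * B ^ 2) := by
    have : B ^ (2 * (p - 1)) = B ^ 2 * ((B ^ 2) ^ (2 - p))⁻¹ := by
      rw [← Real.rpow_natCast B 2, ← Real.rpow_mul hB.le, ← Real.rpow_neg hB.le,
        ← Real.rpow_add hB]
      congr 1
      push_cast
      ring
    rw [hc, Real.div_rpow (by positivity) hA.le, this]
    field_simp
  rw [e1, ENNReal.ofReal_mul (by positivity), ENNReal.ofReal_inv_of_pos hcp, mul_assoc]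
  refine le_trans (le_of_eq ?_) (mul_le_mul' le_rfl key)
  rw [← mul_assoc, ENNReal.inv_mul_cancel (ENNReal.ofReal_pos.2 hcp).ne' ENNReal.ofReal_ne_top,
    one_mul]

end Truncation

/-! ### Dominating functions in `L_p` -/

section SquareFunctions

variable {Ω : Type*} [MeasurableSpace Ω] {μ : Measure Ω} {E : Type*} [NormedAddCommGroup E]

lemma eLpNorm_ofReal_eq {ε : Type*} [TopologicalSpace ε] [ESeminormedAddMonoid ε] {p : ℝ}
    (hp : 0 < p) (f : Ω → ε) :
    eLpNorm f (ENNReal.ofReal p) μ = (∫⁻ x, ‖f x‖ₑ ^ p ∂μ) ^ (1 / p) := by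
  rw [eLpNorm_eq_lintegral_rpow_enorm_toReal (ENNReal.ofReal_pos.2 hp).ne' ENNReal.ofReal_ne_top,
    ENNReal.toReal_ofReal hp.le]

lemma eLpNorm_ofReal_lt_top_iff {ε : Type*} [TopologicalSpace ε] [ESeminormedAddMonoid ε] {p : ℝ}
    (hp : 0 < p) {f : Ω → ε} :
    eLpNorm f (ENNReal.ofReal p) μ < ∞ ↔ ∫⁻ x, ‖f x‖ₑ ^ p ∂μ < ∞ := by
  rw [eLpNorm_ofReal_eq hp, ENNReal.rpow_lt_top_iff_of_pos (by positivity)]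

lemma ae_lt_top_of_memLp {p : ℝ} (hp : 0 < p) {P : Ω → ℝ≥0∞} (hP : MemLp P (ENNReal.ofReal p) μ) :
    ∀ᵐ x ∂μ, P x < ∞ := by
  have h := (eLpNorm_ofReal_lt_top_iff hp).1 hP.2
  filter_upwards [ae_lt_top' (hP.1.aemeasurable.enorm.pow_const p) h.ne] with x hx
  simpa using (ENNReal.rpow_lt_top_iff_of_pos hp).1 hx

/-- Minkowski's inequality for series, qualitative form. -/
lemma memLp_tsum_enorm {p : ℝ} (hp : 1 ≤ p) {b : ℕ → Ω → E}
    (hb : ∀ k, AEStronglyMeasurable (b k) μ)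
    (h : ∑' k, eLpNorm (b k) (ENNReal.ofReal p) μ ≠ ∞) :
    MemLp (fun x => ∑' k, ‖b k x‖ₑ) (ENNReal.ofReal p) μ := by
  have hp0 : 0 < p := zero_lt_one.trans_le hp
  have hm : ∀ k, AEMeasurable (fun x => ‖b k x‖ₑ) μ := fun k => (hb k).enorm
  refine ⟨(AEMeasurable.tsum hm).aestronglyMeasurable, ?_⟩
  set M := ∑' k, eLpNorm (b k) (ENNReal.ofReal p) μ
  have hpart : ∀ n, ∫⁻ x, (∑ k ∈ Finset.range n, ‖b k x‖ₑ) ^ p ∂μ ≤ M ^ p := by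
    intro n
    have h1 : eLpNorm (∑ k ∈ Finset.range n, fun x => ‖b k x‖ₑ) (ENNReal.ofReal p) μ ≤ M := by
      refine (eLpNorm_sum_le (fun k _ => (hm k).aestronglyMeasurable)
        (by simpa using ENNReal.ofReal_le_ofReal hp)).trans ?_
      simp_rw [eLpNorm_enorm]
      exact ENNReal.sum_le_tsum _
    rw [eLpNorm_ofReal_eq hp0, ← ENNReal.rpow_le_rpow_iff hp0, ← ENNReal.rpow_mul,
      one_div_mul_cancel hp0.ne', ENNReal.rpow_one] at h1
    simpa using h1
  rw [eLpNorm_ofReal_lt_top_iff hp0]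
  have hlim := lintegral_tendsto_of_tendsto_of_monotone (μ := μ)
    (f := fun n x => (∑ k ∈ Finset.range n, ‖b k x‖ₑ) ^ p)
    (F := fun x => (∑' k, ‖b k x‖ₑ) ^ p) (fun n => by fun_prop)
    (ae_of_all _ fun x n n' hn => by
      simp only
      gcongr)
    (ae_of_all _ fun x => (ENNReal.tendsto_nat_tsum _).ennrpow_const p)
  refine (le_of_tendsto' hlim hpart).trans_lt ?_
  exact ENNReal.rpow_lt_top_of_nonneg hp0.le h

/-- The `p`-th power integrates term by term. This `ℓ_p` sum replaces `sup_k ‖b k‖`: it dominates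
every term, and its finiteness forces the terms to `0`. -/
lemma memLp_tsum_rpow_enorm {p : ℝ} (hp : 0 < p) {b : ℕ → Ω → E}
    (hb : ∀ k, AEStronglyMeasurable (b k) μ) {β : ℕ → ℝ} (hβ : ∀ k, 0 ≤ β k)
    (hbβ : ∀ k, eLpNorm (b k) (ENNReal.ofReal p) μ ≤ ENNReal.ofReal (β k))
    (hs : Summable fun k => β k ^ p) :
    MemLp (fun x => (∑' k, ‖b k x‖ₑ ^ p) ^ (1 / p)) (ENNReal.ofReal p) μ := by
  have hm : ∀ k, AEMeasurable (fun x => ‖b k x‖ₑ ^ p) μ := fun k => (hb k).enorm.pow_const p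
  refine ⟨((AEMeasurable.tsum hm).pow_const _).aestronglyMeasurable, ?_⟩
  rw [eLpNorm_ofReal_lt_top_iff hp]
  simp_rw [enorm_eq_self, ← ENNReal.rpow_mul, one_div_mul_cancel hp.ne', ENNReal.rpow_one]
  rw [lintegral_tsum hm]
  refine lt_of_le_of_lt (ENNReal.tsum_le_tsum fun k => ?_) hs.tsum_ofReal_lt_top
  have := hbβ k
  rw [eLpNorm_ofReal_eq hp, ← ENNReal.rpow_le_rpow_iff hp, ← ENNReal.rpow_mul,
    one_div_mul_cancel hp.ne', ENNReal.rpow_one] at this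
  rwa [ENNReal.ofReal_rpow_of_nonneg (hβ k) hp.le] at this

lemma le_tsum_rpow {p : ℝ} (hp : 0 < p) (b : ℕ → ℝ≥0∞) (k : ℕ) :
    b k ≤ (∑' k, b k ^ p) ^ (1 / p) := by
  rw [← ENNReal.rpow_le_rpow_iff hp, ← ENNReal.rpow_mul, one_div_mul_cancel hp.ne',
    ENNReal.rpow_one]
  exact ENNReal.le_tsum k

lemma tendsto_zero_of_tsum_rpow {p : ℝ} (hp : 0 < p) {b : ℕ → ℝ≥0∞}
    (h : (∑' k, b k ^ p) ^ (1 / p) < ∞) : Tendsto b atTop (𝓝 0) := by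
  rw [ENNReal.rpow_lt_top_iff_of_pos (by positivity)] at h
  have h1 := (ENNReal.tendsto_atTop_zero_of_tsum_ne_top h.ne).ennrpow_const (1 / p)
  simpa [← ENNReal.rpow_mul, mul_inv_cancel₀ hp.ne', hp] using h1

end SquareFunctions

/-! ### Pointwise Abel summation along blocks -/

section AbelSummation

variable {H : Type*} [NormedAddCommGroup H] [NormedSpace ℂ H]

lemma exists_block {m : ℕ → ℕ} (hm : StrictMono m) {k₀ n : ℕ} (hn : m k₀ ≤ n) :
    ∃ k, k₀ ≤ k ∧ m k ≤ n ∧ n < m (k + 1) := by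
  have h0 : k₀ ≤ n := hm.le_apply.trans hn
  refine ⟨Nat.findGreatest (fun k => m k ≤ n) n, Nat.le_findGreatest h0 hn,
    Nat.findGreatest_spec (P := fun k => m k ≤ n) h0 hn, ?_⟩
  by_contra! h
  have := Nat.le_findGreatest (P := fun k => m k ≤ n) (hm.le_apply.trans h) h
  omega

lemma sum_smul_eq_abel (w : ℕ → ℂ) (v : ℕ → H) (n : ℕ) :
    ∑ k ∈ Finset.Icc 1 (n + 1), w k • v k = w (n + 1) • ∑ k ∈ Finset.Icc 1 (n + 1), v k +
      ∑ i ∈ Finset.range n, (w (i + 1) - w (i + 2)) • ∑ k ∈ Finset.Icc 1 (i + 1), v k := by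
  induction n with
  | zero => simp
  | succ n ih =>
    rw [Finset.sum_Icc_succ_top (by omega), ih, Finset.sum_range_succ,
      Finset.sum_Icc_succ_top (by omega : 1 ≤ n + 1 + 1) v, sub_smul, smul_add]
    abel

lemma IsWeight.one_le {W : ℕ → ℝ} (hW : IsWeight W) {n : ℕ} (hn : 1 ≤ n) : 1 ≤ W n :=
  hW.2.1.trans (hW.1 (Set.mem_Ici.2 le_rfl) hn hn)

lemma IsWeight.enorm_inv_le {W : ℕ → ℝ} (hW : IsWeight W) {k n : ℕ} (hk : 1 ≤ k) (hkn : k ≤ n) :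
    ‖(W n : ℂ)⁻¹‖ₑ ≤ ‖(W k : ℂ)⁻¹‖ₑ := by
  have h1 := hW.one_le hk
  have h2 := hW.1 (Set.mem_Ici.2 hk) (Set.mem_Ici.2 (hk.trans hkn)) hkn
  rw [enorm_le_iff_norm_le, norm_inv, norm_inv, Complex.norm_real, Complex.norm_real,
    Real.norm_of_nonneg (by linarith), Real.norm_of_nonneg (by linarith)]
  gcongr

lemma IsWeight.enorm_inv_le_one {W : ℕ → ℝ} (hW : IsWeight W) {n : ℕ} (hn : 1 ≤ n) :
    ‖(W n : ℂ)⁻¹‖ₑ ≤ 1 := by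
  have h1 := hW.one_le hn
  rw [← ofReal_norm, norm_inv, Complex.norm_real, Real.norm_of_nonneg (by linarith),
    ENNReal.ofReal_le_one]
  exact inv_le_one_of_one_le₀ h1

/-- Since `W` is nondecreasing, `1 / W n` may be replaced by `1 / W k`; the terms past `k` are then
bounded crudely, uniformly for `n` in the block. -/
lemma enorm_smul_sum_le_of_block {W : ℕ → ℝ} (hW : IsWeight W) (v : ℕ → H) {k l n : ℕ}
    (hk : 1 ≤ k) (hkn : k ≤ n) (hnl : n ≤ l) :
    ‖(W n : ℂ)⁻¹ • ∑ j ∈ Finset.Icc 1 n, v j‖ₑ ≤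
      ‖(W k : ℂ)⁻¹ • ∑ j ∈ Finset.Icc 1 k, v j‖ₑ +
      ‖(W k : ℂ)⁻¹‖ₑ * ∑ j ∈ Finset.Ioc k l, ‖v j‖ₑ := by
  have h1 : ∑ j ∈ Finset.Icc 1 n, v j = ∑ j ∈ Finset.Icc 1 k, v j + ∑ j ∈ Finset.Ioc k n, v j := by
    have : ∀ n, Finset.Icc 1 n = Finset.Ioc 0 n := fun n => by ext; simp; omega
    rw [this, this, Finset.sum_Ioc_consecutive _ (Nat.zero_le _) hkn]
  have h2 : ‖∑ j ∈ Finset.Ioc k n, v j‖ₑ ≤ ∑ j ∈ Finset.Ioc k l, ‖v j‖ₑ :=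
    (enorm_sum_le _ _).trans (Finset.sum_le_sum_of_subset (Finset.Ioc_subset_Ioc_right hnl))
  rw [enorm_smul, enorm_smul, ← mul_add, h1]
  exact mul_le_mul' (hW.enorm_inv_le hk hkn)
    ((enorm_add_le _ _).trans (add_le_add le_rfl h2))

lemma enorm_sum_inv_smul_le {W : ℕ → ℝ} (hW : IsWeight W) {m : ℕ → ℕ} (hm : StrictMono m)
    (hm1 : ∀ k, 1 ≤ m k) (v : ℕ → H) {P₁ P₂ : ℝ≥0∞}
    (h₁ : ∀ k, ‖(W (m k) : ℂ)⁻¹ • ∑ j ∈ Finset.Icc 1 (m k), v j‖ₑ ≤ P₁)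
    (h₂ : ∀ k, ‖(W (m k) : ℂ)⁻¹‖ₑ * ∑ j ∈ Finset.Ioc (m k) (m (k + 1)), ‖v j‖ₑ ≤ P₂) (n : ℕ) :
    ‖∑ k ∈ Finset.Icc 1 n, (W k : ℂ)⁻¹ • v k‖ₑ ≤
      ∑ j ∈ Finset.Icc 1 (m 0), ‖v j‖ₑ + (P₁ + P₂) +
      ∑' i, ‖((W (i + 1) : ℂ)⁻¹ - (W (i + 2) : ℂ)⁻¹) • ∑ k ∈ Finset.Icc 1 (i + 1), v k‖ₑ := by
  rcases n with _ | n
  · simp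
  rw [sum_smul_eq_abel (fun k => (W k : ℂ)⁻¹)]
  refine (enorm_add_le _ _).trans (add_le_add ?_ ((enorm_sum_le _ _).trans
    (ENNReal.sum_le_tsum _)))
  -- Indices below `m 0` lie in no block; there `1 / W ≤ 1` and a fixed finite sum suffice.
  rcases lt_or_ge (n + 1) (m 0) with h | h
  · refine le_add_right ?_
    rw [enorm_smul]
    refine (mul_le_of_le_one_left' (hW.enorm_inv_le_one (by omega))).trans ?_
    exact (enorm_sum_le _ _).trans
      (Finset.sum_le_sum_of_subset (Finset.Icc_subset_Icc_right h.le))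
  · obtain ⟨k, -, hk1, hk2⟩ := exists_block hm h
    refine le_add_left ?_
    exact (enorm_smul_sum_le_of_block hW v (hm1 k) hk1 hk2.le).trans (add_le_add (h₁ k) (h₂ k))

/-- The boundary term of Abel summation tends to `0` by the block estimate, and the remaining series
converges absolutely. -/
lemma exists_tendsto_sum_inv_smul [CompleteSpace H] {W : ℕ → ℝ} (hW : IsWeight W) {m : ℕ → ℕ}
    (hm : StrictMono m) (hm1 : ∀ k, 1 ≤ m k) (v : ℕ → H)
    (h₁ : Tendsto (fun k => ‖(W (m k) : ℂ)⁻¹ • ∑ j ∈ Finset.Icc 1 (m k), v j‖ₑ) atTop (𝓝 0))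
    (h₂ : Tendsto (fun k => ‖(W (m k) : ℂ)⁻¹‖ₑ * ∑ j ∈ Finset.Ioc (m k) (m (k + 1)), ‖v j‖ₑ)
      atTop (𝓝 0))
    (h₃ : ∑' i, ‖((W (i + 1) : ℂ)⁻¹ - (W (i + 2) : ℂ)⁻¹) • ∑ k ∈ Finset.Icc 1 (i + 1), v k‖ₑ < ∞) :
    ∃ s : H, Tendsto (fun n => ∑ k ∈ Finset.Icc 1 n, (W k : ℂ)⁻¹ • v k) atTop (𝓝 s) := by
  have hsum := (Summable.of_enorm h₃.ne).hasSum.tendsto_sum_nat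
  have h0 : Tendsto (fun n => (W n : ℂ)⁻¹ • ∑ j ∈ Finset.Icc 1 n, v j) atTop (𝓝 0) := by
    rw [tendsto_zero_iff_enorm_tendsto_zero, ENNReal.tendsto_atTop_zero]
    intro ε hε
    have h12 := h₁.add h₂
    rw [add_zero, ENNReal.tendsto_atTop_zero] at h12
    obtain ⟨k₀, hk₀⟩ := h12 ε hε
    refine ⟨m k₀, fun n hn => ?_⟩
    obtain ⟨k, hk, hk1, hk2⟩ := exists_block hm hn
    exact (enorm_smul_sum_le_of_block hW v (hm1 k) hk1 hk2.le).trans (hk₀ k hk)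
  have h1 := ((tendsto_add_atTop_iff_nat 1).2 h0).add hsum
  rw [zero_add] at h1
  refine ⟨_, (tendsto_add_atTop_iff_nat 1).1 (h1.congr fun n => ?_)⟩
  rw [sum_smul_eq_abel (fun k => (W k : ℂ)⁻¹)]

end AbelSummation

/-! ### From moment bounds to convergence and the maximal inequality -/

section Maximal

variable {Ω : Type*} [MeasurableSpace Ω] {μ : Measure Ω}
  {H : Type*} [NormedAddCommGroup H] [NormedSpace ℂ H] [CompleteSpace H]

lemma enorm_complex_inv {r : ℝ} (hr : 0 ≤ r) : ‖(r : ℂ)⁻¹‖ₑ = ENNReal.ofReal r⁻¹ := by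
  rw [← ofReal_norm, norm_inv, Complex.norm_real, Real.norm_of_nonneg hr]

/-- Almost everywhere convergence and a maximal inequality for weighted sums, from moment bounds
on the unweighted sums. -/
theorem ae_tendsto_and_memLp_iSup {p : ℝ} (hp : 1 ≤ p) {g : ℕ → Ω → H}
    (hg : ∀ k, AEStronglyMeasurable (g k) μ) {F W : ℕ → ℝ} {C K : ℝ} (hC0 : 0 ≤ C) (hK0 : 0 ≤ K)
    (hF : ∀ n, 1 ≤ n → 0 ≤ F n)
    (hC : ∀ k, 1 ≤ k → eLpNorm (g k) (ENNReal.ofReal p) μ ≤ ENNReal.ofReal C)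
    (hK : ∀ n, 1 ≤ n → eLpNorm (fun x => ∑ k ∈ Finset.Icc 1 n, g k x) (ENNReal.ofReal p) μ ≤
      ENNReal.ofReal (K * F n))
    (hW : W ∈ Admissible p F) (hV : SummableVariation F W) :
    (∀ᵐ x ∂μ, ∃ s : H,
      Tendsto (fun n => ∑ k ∈ Finset.Icc 1 n, (W k : ℂ)⁻¹ • g k x) atTop (𝓝 s)) ∧
    MemLp (fun x => ⨆ n : ℕ, ‖∑ k ∈ Finset.Icc 1 n, (W k : ℂ)⁻¹ • g k x‖ₑ)
      (ENNReal.ofReal p) μ := by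
  obtain ⟨hWw, m, hm, hm1, hs1, hs2⟩ := hW
  have hp0 : 0 < p := zero_lt_one.trans_le hp
  have hq1 : 1 ≤ ENNReal.ofReal p := by simpa using ENNReal.ofReal_le_ofReal hp
  have hWpos : ∀ n, 1 ≤ n → 0 < W n := fun n hn => zero_lt_one.trans_le (hWw.one_le hn)
  have hSm : ∀ n, AEStronglyMeasurable (fun x => ∑ k ∈ Finset.Icc 1 n, g k x) μ := fun n => by
    fun_prop
  -- The dominating pieces: indices up to `m 0`, boundary terms at `m k`, growth inside a block, and
  -- Abel increments.
  set M₀ : Ω → ℝ≥0∞ := fun x => ∑ j ∈ Finset.Icc 1 (m 0), ‖g j x‖ₑ with hM₀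
  set b₁ : ℕ → Ω → H := fun k x => (W (m k) : ℂ)⁻¹ • ∑ j ∈ Finset.Icc 1 (m k), g j x with hb₁
  set b₂ : ℕ → Ω → ℝ := fun k x =>
    (W (m k))⁻¹ * ∑ j ∈ Finset.Ioc (m k) (m (k + 1)), ‖g j x‖ with hb₂
  set b₃ : ℕ → Ω → H := fun i x =>
    ((W (i + 1) : ℂ)⁻¹ - (W (i + 2) : ℂ)⁻¹) • ∑ k ∈ Finset.Icc 1 (i + 1), g k x with hb₃
  have hb₂e : ∀ k x, ‖b₂ k x‖ₑ =
      ‖(W (m k) : ℂ)⁻¹‖ₑ * ∑ j ∈ Finset.Ioc (m k) (m (k + 1)), ‖g j x‖ₑ := by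
    intro k x
    have h1 : 0 ≤ (W (m k))⁻¹ := inv_nonneg.2 (hWpos _ (hm1 k)).le
    have h2 : 0 ≤ ∑ j ∈ Finset.Ioc (m k) (m (k + 1)), ‖g j x‖ := by positivity
    rw [enorm_complex_inv (hWpos _ (hm1 k)).le, ← ofReal_norm, hb₂,
      Real.norm_of_nonneg (mul_nonneg h1 h2), ENNReal.ofReal_mul h1,
      ENNReal.ofReal_sum_of_nonneg fun _ _ => norm_nonneg _]
    simp_rw [ofReal_norm]
  have hM₀L : MemLp M₀ (ENNReal.ofReal p) μ := by
    refine memLp_finsetSum _ fun j hj => ?_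
    refine ⟨(hg j).enorm.aestronglyMeasurable, ?_⟩
    rw [eLpNorm_enorm]
    exact (hC j (Finset.mem_Icc.1 hj).1).trans_lt ENNReal.ofReal_lt_top
  have hM₁L : MemLp (fun x => (∑' k, ‖b₁ k x‖ₑ ^ p) ^ (1 / p)) (ENNReal.ofReal p) μ := by
    refine memLp_tsum_rpow_enorm hp0 (fun k => (hSm (m k)).const_smul _)
      (β := fun k => K * (F (m k) / W (m k))) (fun k => ?_) (fun k => ?_) ?_
    · exact mul_nonneg hK0 (div_nonneg (hF _ (hm1 k)) (hWpos _ (hm1 k)).le)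
    · refine (eLpNorm_const_smul_le (c := (W (m k) : ℂ)⁻¹)
        (f := fun x => ∑ j ∈ Finset.Icc 1 (m k), g j x)).trans ?_
      rw [enorm_complex_inv (hWpos _ (hm1 k)).le]
      refine (mul_le_mul' le_rfl (hK _ (hm1 k))).trans ?_
      rw [← ENNReal.ofReal_mul (inv_nonneg.2 (hWpos _ (hm1 k)).le)]
      refine ENNReal.ofReal_le_ofReal (le_of_eq ?_)
      rw [div_eq_mul_inv]
      ring
    · refine (hs1.mul_left (K ^ p)).congr fun k => ?_
      rw [Real.mul_rpow hK0 (div_nonneg (hF _ (hm1 k)) (hWpos _ (hm1 k)).le)]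
  have hM₂L : MemLp (fun x => (∑' k, ‖b₂ k x‖ₑ ^ p) ^ (1 / p)) (ENNReal.ofReal p) μ := by
    have hsub : ∀ k, (0 : ℝ) ≤ (m (k + 1) : ℝ) - m k := fun k =>
      sub_nonneg.2 (Nat.cast_le.2 (hm.monotone (Nat.le_succ k)))
    refine memLp_tsum_rpow_enorm hp0 (fun k => ?_)
      (β := fun k => C * (((m (k + 1) : ℝ) - m k) / W (m k))) (fun k => ?_) (fun k => ?_) ?_
    · simp only [hb₂]
      fun_prop
    · exact mul_nonneg hC0 (div_nonneg (hsub k) (hWpos _ (hm1 k)).le)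
    · have e1 : b₂ k = (W (m k))⁻¹ • ∑ j ∈ Finset.Ioc (m k) (m (k + 1)), fun x => ‖g j x‖ := by
        ext x
        simp [hb₂]
      rw [e1]
      refine (eLpNorm_const_smul_le (c := (W (m k))⁻¹)).trans ?_
      have e2 : ‖(W (m k))⁻¹‖ₑ = ENNReal.ofReal (W (m k))⁻¹ :=
        Real.enorm_of_nonneg (inv_nonneg.2 (hWpos _ (hm1 k)).le)
      rw [e2]
      refine (mul_le_mul' le_rfl ((eLpNorm_sum_le (fun j _ => (hg j).norm) hq1).trans
        (Finset.sum_le_card_nsmul _ _ (ENNReal.ofReal C) fun j hj => ?_))).trans ?_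
      · rw [eLpNorm_norm]
        exact hC j (by have := hm1 k; have := (Finset.mem_Ioc.1 hj).1; omega)
      · rw [Nat.card_Ioc, nsmul_eq_mul, ← ENNReal.ofReal_natCast,
          ← ENNReal.ofReal_mul (Nat.cast_nonneg _),
          ← ENNReal.ofReal_mul (inv_nonneg.2 (hWpos _ (hm1 k)).le),
          Nat.cast_sub (hm.monotone (Nat.le_succ k))]
        refine ENNReal.ofReal_le_ofReal (le_of_eq ?_)
        rw [div_eq_mul_inv]
        ring
    · refine (hs2.mul_left (C ^ p)).congr fun k => ?_
      rw [Real.mul_rpow hC0 (div_nonneg (hsub k) (hWpos _ (hm1 k)).le)]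
  have hM₃L : MemLp (fun x => ∑' i, ‖b₃ i x‖ₑ) (ENNReal.ofReal p) μ := by
    refine memLp_tsum_enorm hp (fun i => (hSm (i + 1)).const_smul _) ?_
    refine (lt_of_le_of_lt (ENNReal.tsum_le_tsum fun i => ?_)
      (hV.mul_left K).tsum_ofReal_lt_top).ne
    refine (eLpNorm_const_smul_le (c := (W (i + 1) : ℂ)⁻¹ - (W (i + 2) : ℂ)⁻¹)
      (f := fun x => ∑ j ∈ Finset.Icc 1 (i + 1), g j x)).trans ?_
    have hw1 := hWpos (i + 1) (by omega)
    have hw2 := hWpos (i + 2) (by omega)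
    have hw : (W (i + 2))⁻¹ ≤ (W (i + 1))⁻¹ :=
      inv_anti₀ hw1 (hWw.1 (Set.mem_Ici.2 (by omega)) (Set.mem_Ici.2 (by omega)) (by omega))
    have e1 : ‖(W (i + 1) : ℂ)⁻¹ - (W (i + 2) : ℂ)⁻¹‖ₑ
        = ENNReal.ofReal ((W (i + 1))⁻¹ - (W (i + 2))⁻¹) := by
      rw [← ofReal_norm, ← Complex.ofReal_inv, ← Complex.ofReal_inv, ← Complex.ofReal_sub,
        Complex.norm_real, Real.norm_of_nonneg (sub_nonneg.2 hw)]
    rw [e1]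
    refine (mul_le_mul' le_rfl (hK _ (by omega))).trans ?_
    rw [← ENNReal.ofReal_mul (sub_nonneg.2 hw)]
    refine ENNReal.ofReal_le_ofReal (le_of_eq ?_)
    -- Here `(1/W - 1/W') F = (F/W)(1 - W/W')`, exactly the summand in `SummableVariation`.
    field_simp
  constructor
  · filter_upwards [ae_lt_top_of_memLp hp0 hM₁L, ae_lt_top_of_memLp hp0 hM₂L,
      ae_lt_top_of_memLp hp0 hM₃L] with x h1 h2 h3
    refine exists_tendsto_sum_inv_smul hWw hm hm1 (fun k => g k x)
      (tendsto_zero_of_tsum_rpow hp0 h1) ?_ h3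
    have := tendsto_zero_of_tsum_rpow hp0 h2
    simpa only [hb₂e] using this
  · have hML := (hM₀L.add (hM₁L.add hM₂L)).add hM₃L
    refine ⟨AEMeasurable.aestronglyMeasurable (AEMeasurable.iSup fun n =>
      AEStronglyMeasurable.enorm (by fun_prop)), lt_of_le_of_lt (eLpNorm_mono_enorm fun x => ?_) hML.2⟩
    rw [enorm_eq_self, enorm_eq_self]
    refine iSup_le fun n => ?_
    refine enorm_sum_inv_smul_le hWw hm hm1 (fun k => g k x)
      (fun k => le_tsum_rpow hp0 (fun k => ‖b₁ k x‖ₑ) k) (fun k => ?_) n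
    rw [← hb₂e]
    exact le_tsum_rpow hp0 (fun k => ‖b₂ k x‖ₑ) k

end Maximal

/-! ### Moment bounds for contractions and Dunford–Schwartz operators -/

section Operators

variable {Ω : Type*} [MeasurableSpace Ω] {μ : Measure Ω}
  {H : Type*} [NormedAddCommGroup H] [InnerProductSpace ℂ H]

lemma coeFn_sum_smul {q : ℝ≥0∞} {ι : Type*} (s : Finset ι) (a : ι → ℂ) (f : ι → Lp H q μ) :
    (∑ k ∈ s, a k • f k : Lp H q μ) =ᵐ[μ] fun x => ∑ k ∈ s, a k • f k x := by
  classical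
  induction s using Finset.induction_on with
  | empty =>
    simp only [Finset.sum_empty]
    exact Lp.coeFn_zero H q μ
  | insert i s hi ih =>
    rw [Finset.sum_insert hi]
    filter_upwards [Lp.coeFn_add (a i • f i) (∑ k ∈ s, a k • f k), Lp.coeFn_smul (a i) (f i), ih]
      with x h1 h2 h3
    rw [h1, Pi.add_apply, h2, h3, Finset.sum_insert hi, Pi.smul_apply]

lemma eLpNorm_eq_ofReal_norm {E : Type*} [NormedAddCommGroup E] {q : ℝ≥0∞} (f : Lp E q μ) :
    eLpNorm f q μ = ENNReal.ofReal ‖f‖ := by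
  rw [Lp.norm_def, ENNReal.ofReal_toReal (Lp.eLpNorm_ne_top f)]

lemma norm_pow_apply_le {E : Type*} [NormedAddCommGroup E] [NormedSpace ℂ E] {T : E →L[ℂ] E}
    (hT : ‖T‖ ≤ 1) (k : ℕ) (f : E) : ‖(T ^ k) f‖ ≤ ‖f‖ := by
  induction k with
  | zero => simp
  | succ k ih =>
    rw [pow_succ']
    exact (T.le_of_opNorm_le hT _).trans (by rw [one_mul]; exact ih)

lemma hilbertSum_eq {q : ℝ≥0∞} [Fact (1 ≤ q)] (a : ℕ → ℂ) (e : ℕ → ℕ) (W : ℕ → ℝ)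
    (T : Lp H q μ →L[ℂ] Lp H q μ) (f : Lp H q μ) (n : ℕ) (x : Ω) :
    hilbertSum a e W T f n x =
      ∑ k ∈ Finset.Icc 1 n, (W k : ℂ)⁻¹ • (a k • ((T ^ e k) f : Lp H q μ) x) := by
  refine Finset.sum_congr rfl fun k _ => ?_
  rw [smul_smul, div_eq_inv_mul]

lemma eLpNorm_le_of_isDunfordSchwartz [SFinite μ] {T : Lp H 1 μ →L[ℂ] Lp H 1 μ}
    (hT : IsDunfordSchwartz μ T) (f : Lp H 1 μ) {p : ℝ} (hp : 1 < p) :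
    eLpNorm (T f) (ENNReal.ofReal p) μ ≤ eLpNorm f (ENNReal.ofReal p) μ := by
  have hp0 : 0 < p := zero_lt_one.trans hp
  rw [eLpNorm_ofReal_eq hp0, eLpNorm_ofReal_eq hp0]
  exact ENNReal.rpow_le_rpow (lintegral_rpow_le_of_isDunfordSchwartz hT f hp) (by positivity)

lemma eLpNorm_pow_le_of_isDunfordSchwartz [SFinite μ] {T : Lp H 1 μ →L[ℂ] Lp H 1 μ}
    (hT : IsDunfordSchwartz μ T) (f : Lp H 1 μ) {p : ℝ} (hp : 1 < p) (k : ℕ) :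
    eLpNorm ((T ^ k) f : Lp H 1 μ) (ENNReal.ofReal p) μ ≤ eLpNorm f (ENNReal.ofReal p) μ := by
  induction k with
  | zero => simp
  | succ k ih =>
    rw [pow_succ']
    exact (eLpNorm_le_of_isDunfordSchwartz hT _ hp).trans ih

/-- A Dunford–Schwartz operator induces a contraction of `L_2`. -/
lemma exists_contraction_L2_of_isDunfordSchwartz [IsFiniteMeasure μ]
    {T : Lp H 1 μ →L[ℂ] Lp H 1 μ} (hT : IsDunfordSchwartz μ T) :
    ∃ T₂ : Lp H 2 μ →L[ℂ] Lp H 2 μ, ‖T₂‖ ≤ 1 ∧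
      ∀ (f : Lp H 1 μ) (g : Lp H 2 μ), f =ᵐ[μ] g → T f =ᵐ[μ] T₂ g := by
  -- Finite measure gives `L_2 ⊆ L_1`, so `T` acts on `L_2` directly, without extension by density.
  have h1 : ∀ g : Lp H 2 μ, MemLp g 1 μ := fun g => (Lp.memLp g).mono_exponent one_le_two
  have hle : ∀ f : Lp H 1 μ, eLpNorm (T f) 2 μ ≤ eLpNorm f 2 μ := fun f => by
    simpa using eLpNorm_le_of_isDunfordSchwartz hT f one_lt_two
  have h2 : ∀ g : Lp H 2 μ, eLpNorm (T ((h1 g).toLp g)) 2 μ ≤ eLpNorm g 2 μ := fun g =>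
    (hle _).trans_eq (eLpNorm_congr_ae (h1 g).coeFn_toLp)
  have h3 : ∀ g : Lp H 2 μ, MemLp (T ((h1 g).toLp g)) 2 μ := fun g =>
    ⟨Lp.aestronglyMeasurable _, (h2 g).trans_lt (Lp.memLp g).2⟩
  let L : Lp H 2 μ →ₗ[ℂ] Lp H 2 μ :=
    { toFun := fun g => (h3 g).toLp _
      map_add' := fun f g => by
        rw [← MemLp.toLp_add, MemLp.toLp_eq_toLp_iff]
        have : (h1 (f + g)).toLp _ = (h1 f).toLp _ + (h1 g).toLp _ := by
          rw [← MemLp.toLp_add, MemLp.toLp_eq_toLp_iff]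
          exact Lp.coeFn_add f g
        rw [this, map_add]
        exact Lp.coeFn_add _ _
      map_smul' := fun c g => by
        rw [RingHom.id_apply, ← MemLp.toLp_const_smul, MemLp.toLp_eq_toLp_iff]
        have : (h1 (c • g)).toLp _ = c • (h1 g).toLp _ := by
          rw [← MemLp.toLp_const_smul, MemLp.toLp_eq_toLp_iff]
          exact Lp.coeFn_smul c g
        rw [this, map_smul]
        exact Lp.coeFn_smul _ _ }
  have hL : ∀ g, ‖L g‖ ≤ 1 * ‖g‖ := fun g => by
    change ‖(h3 g).toLp _‖ ≤ _
    rw [Lp.norm_toLp, one_mul, Lp.norm_def]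
    exact ENNReal.toReal_mono (Lp.memLp g).2.ne (h2 g)
  refine ⟨L.mkContinuous 1 hL, LinearMap.mkContinuous_norm_le _ zero_le_one _, fun f g hfg => ?_⟩
  have h4 : (h1 g).toLp g = f := by
    refine Lp.ext ?_
    exact (h1 g).coeFn_toLp.trans hfg.symm
  exact EventuallyEq.trans (EventuallyEq.of_eq (by rw [h4])) (h3 g).coeFn_toLp.symm

lemma norm_sum_mul_pow_le {G : ℕ → ℝ} (hG : IsWeight G) {e : ℕ → ℕ} {a : ℕ → ℂ} {K : ℝ}
    (hK : ∀ n, 1 ≤ n → ∀ z : ℂ, ‖z‖ = 1 →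
      ‖((G n : ℂ))⁻¹ * ∑ k ∈ Finset.Icc 1 n, a k * z ^ e k‖ ≤ K)
    {n : ℕ} (hn : 1 ≤ n) {z : ℂ} (hz : ‖z‖ = 1) :
    ‖∑ k ∈ Finset.Icc 1 n, a k * z ^ e k‖ ≤ K * G n := by
  have hGn : 0 < G n := zero_lt_one.trans_le (hG.one_le hn)
  have := hK n hn z hz
  rwa [norm_mul, norm_inv, Complex.norm_real, Real.norm_of_nonneg hGn.le,
    inv_mul_le_iff₀ hGn, mul_comm] at this

variable [CompleteSpace H]

lemma norm_sum_smul_pow_le {G : ℕ → ℝ} (hG : IsWeight G) {e : ℕ → ℕ} {a : ℕ → ℂ} {K : ℝ}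
    (hK : ∀ n, 1 ≤ n → ∀ z : ℂ, ‖z‖ = 1 →
      ‖((G n : ℂ))⁻¹ * ∑ k ∈ Finset.Icc 1 n, a k * z ^ e k‖ ≤ K)
    {T : Lp H 2 μ →L[ℂ] Lp H 2 μ} (hT : ‖T‖ ≤ 1) (f : Lp H 2 μ) {n : ℕ} (hn : 1 ≤ n) :
    ‖∑ k ∈ Finset.Icc 1 n, a k • (T ^ e k) f‖ ≤ K * G n * ‖f‖ :=
  norm_sum_pow_le _ a e (fun _ hz => norm_sum_mul_pow_le hG hK hn hz) T hT f

theorem ae_tendsto_and_memLp_iSup_of_contraction {G : ℕ → ℝ} (hG : IsWeight G) {e : ℕ → ℕ}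
    {a : ℕ → ℂ} {C K : ℝ} (hC0 : 0 ≤ C) (ha : ∀ k, 1 ≤ k → ‖a k‖ ≤ C) (hK0 : 0 ≤ K)
    (hK : ∀ n, 1 ≤ n → ∀ z : ℂ, ‖z‖ = 1 →
      ‖((G n : ℂ))⁻¹ * ∑ k ∈ Finset.Icc 1 n, a k * z ^ e k‖ ≤ K)
    {T : Lp H 2 μ →L[ℂ] Lp H 2 μ} (hT : ‖T‖ ≤ 1) (f : Lp H 2 μ)
    {W : ℕ → ℝ} (hW : W ∈ Admissible 2 G) (hV : SummableVariation G W) :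
    (∀ᵐ x ∂μ, ∃ s : H, Tendsto (fun n => hilbertSum a e W T f n x) atTop (𝓝 s)) ∧
      MemLp (fun x => ⨆ n : ℕ, ‖hilbertSum a e W T f n x‖ₑ) 2 μ := by
  simp_rw [hilbertSum_eq]
  have two : ENNReal.ofReal 2 = 2 := ENNReal.ofReal_ofNat 2
  suffices h : _ ∧ MemLp _ (ENNReal.ofReal 2) μ by rwa [two] at h
  refine ae_tendsto_and_memLp_iSup (C := C * ‖f‖) (K := K * ‖f‖) one_le_two
    (g := fun k x => a k • ((T ^ e k) f : Lp H 2 μ) x)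
    (fun k => (Lp.aestronglyMeasurable _).const_smul _) (by positivity) (by positivity)
    (fun n hn => zero_le_one.trans (hG.one_le hn)) (fun k hk => ?_) (fun n hn => ?_) hW hV
  · rw [ENNReal.ofReal_ofNat]
    refine (eLpNorm_const_smul_le (c := a k) (f := ((T ^ e k) f : Lp H 2 μ))).trans ?_
    rw [eLpNorm_eq_ofReal_norm, ENNReal.ofReal_mul hC0, ← ofReal_norm]
    exact mul_le_mul' (ENNReal.ofReal_le_ofReal (ha k hk))
      (ENNReal.ofReal_le_ofReal (norm_pow_apply_le hT _ _))
  · rw [ENNReal.ofReal_ofNat, ← eLpNorm_congr_ae (coeFn_sum_smul _ a fun k => (T ^ e k) f),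
      eLpNorm_eq_ofReal_norm]
    refine ENNReal.ofReal_le_ofReal ((norm_sum_smul_pow_le hG hK hT f hn).trans_eq ?_)
    ring

/-- On a bounded `f`, the orbit of `T` agrees a.e. with that of the induced `L_2` contraction, where
von Neumann's inequality applies. This supplies the `L_2` endpoint for interpolation. -/
lemma lintegral_sq_sum_smul_pow_le [IsFiniteMeasure μ] {G : ℕ → ℝ} (hG : IsWeight G) {e : ℕ → ℕ}
    {a : ℕ → ℂ} {K : ℝ} (hK0 : 0 ≤ K)
    (hK : ∀ n, 1 ≤ n → ∀ z : ℂ, ‖z‖ = 1 →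
      ‖((G n : ℂ))⁻¹ * ∑ k ∈ Finset.Icc 1 n, a k * z ^ e k‖ ≤ K)
    {T : Lp H 1 μ →L[ℂ] Lp H 1 μ} (hT : IsDunfordSchwartz μ T) {f : Lp H 1 μ} (hf : MemLp f ∞ μ)
    {n : ℕ} (hn : 1 ≤ n) :
    ∫⁻ x, ‖(∑ k ∈ Finset.Icc 1 n, a k • T ^ e k) f x‖ₑ ^ (2 : ℝ) ∂μ ≤
      ENNReal.ofReal ((K * G n) ^ 2) * ∫⁻ x, ‖f x‖ₑ ^ (2 : ℝ) ∂μ := by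
  obtain ⟨T₂, hT₂, hTT₂⟩ := exists_contraction_L2_of_isDunfordSchwartz hT
  have hf2 : MemLp f 2 μ := hf.mono_exponent le_top
  set g : Lp H 2 μ := hf2.toLp f with hg
  have hpow : ∀ k, ((T ^ k) f : Lp H 1 μ) =ᵐ[μ] ((T₂ ^ k) g : Lp H 2 μ) := fun k => by
    induction k with
    | zero => simpa using hf2.coeFn_toLp.symm
    | succ k ih =>
      rw [pow_succ', pow_succ']
      exact hTT₂ _ _ ih
  have hS : (∑ k ∈ Finset.Icc 1 n, a k • T ^ e k) f
      =ᵐ[μ] (∑ k ∈ Finset.Icc 1 n, a k • (T₂ ^ e k) g : Lp H 2 μ) := by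
    rw [sum_apply]
    refine (coeFn_sum_smul _ a fun k => (T ^ e k) f).trans
      (EventuallyEq.trans ?_ (coeFn_sum_smul _ a fun k => (T₂ ^ e k) g).symm)
    filter_upwards [ae_all_iff.2 fun k => hpow (e k)] with x hx
    simp_rw [hx]
  have hGn : 0 ≤ K * G n := mul_nonneg hK0 (zero_le_one.trans (hG.one_le hn))
  have key : eLpNorm ((∑ k ∈ Finset.Icc 1 n, a k • T ^ e k) f) (ENNReal.ofReal 2) μ ≤
      ENNReal.ofReal (K * G n) * eLpNorm f (ENNReal.ofReal 2) μ := by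
    rw [ENNReal.ofReal_ofNat, eLpNorm_congr_ae hS, ← eLpNorm_congr_ae hf2.coeFn_toLp,
      eLpNorm_eq_ofReal_norm, eLpNorm_eq_ofReal_norm, ← ENNReal.ofReal_mul hGn]
    exact ENNReal.ofReal_le_ofReal (norm_sum_smul_pow_le hG hK hT₂ g hn)
  rw [eLpNorm_ofReal_eq two_pos, eLpNorm_ofReal_eq two_pos,
    ← ENNReal.rpow_le_rpow_iff (two_pos : (0 : ℝ) < 2), ENNReal.mul_rpow_of_nonneg _ _ zero_le_two,
    ← ENNReal.rpow_mul, ← ENNReal.rpow_mul, one_div_mul_cancel two_ne_zero, ENNReal.rpow_one,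
    ENNReal.rpow_one, ENNReal.ofReal_rpow_of_nonneg hGn zero_le_two, Real.rpow_two] at key
  exact key

/-- Interpolation with endpoint constants `C n` on `L_1` and `K G n` on `L_2`; the `p`-th root of `n
^ (2 - p) * G n ^ (2 * (p - 1))` is `interpWeight p G n`. -/
lemma eLpNorm_sum_smul_pow_le [IsFiniteMeasure μ] {G : ℕ → ℝ} (hG : IsWeight G) {e : ℕ → ℕ}
    {a : ℕ → ℂ} {C K : ℝ} (hC0 : 0 < C) (ha : ∀ k, 1 ≤ k → ‖a k‖ ≤ C) (hK0 : 0 < K)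
    (hK : ∀ n, 1 ≤ n → ∀ z : ℂ, ‖z‖ = 1 →
      ‖((G n : ℂ))⁻¹ * ∑ k ∈ Finset.Icc 1 n, a k * z ^ e k‖ ≤ K)
    {p : ℝ} (hp : 1 < p) (hp2 : p < 2)
    {T : Lp H 1 μ →L[ℂ] Lp H 1 μ} (hT : IsDunfordSchwartz μ T) (f : Lp H 1 μ)
    {n : ℕ} (hn : 1 ≤ n) :
    eLpNorm (fun x => ∑ k ∈ Finset.Icc 1 n, a k • ((T ^ e k) f : Lp H 1 μ) x)
      (ENNReal.ofReal p) μ ≤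
    ENNReal.ofReal ((4 * (C ^ (2 - p) * K ^ (2 * (p - 1)))) ^ (1 / p) * interpWeight p G n) *
      eLpNorm f (ENNReal.ofReal p) μ := by
  have hp0 : 0 < p := zero_lt_one.trans hp
  have hGn : 0 < G n := zero_lt_one.trans_le (hG.one_le hn)
  have hn0 : (0 : ℝ) < n := Nat.cast_pos.2 hn
  set S : Lp H 1 μ →L[ℂ] Lp H 1 μ := ∑ k ∈ Finset.Icc 1 n, a k • T ^ e k with hS
  have hSA : ‖S‖ ≤ C * n := by
    refine S.opNorm_le_bound (by positivity) fun h => ?_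
    rw [hS, sum_apply]
    refine (norm_sum_le_of_le (f := fun k => (a k • T ^ e k) h) _ (n := fun _ => C * ‖h‖)
      fun k hk => ?_).trans_eq ?_
    · rw [smul_apply, norm_smul]
      exact mul_le_mul (ha k (Finset.mem_Icc.1 hk).1) (norm_pow_apply_le hT.1 _ _)
        (norm_nonneg _) hC0.le
    · simp
      ring
  have key := lintegral_rpow_le_of_interpolation (A := C * n) (B := K * G n) (by positivity)
    (by positivity) S hSA (fun h hh => lintegral_sq_sum_smul_pow_le hG hK0.le hK hT hh hn) hp hp2 f
  have hSf : (S f : Lp H 1 μ) =ᵐ[μ]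
      fun x => ∑ k ∈ Finset.Icc 1 n, a k • ((T ^ e k) f : Lp H 1 μ) x := by
    rw [hS, sum_apply]
    exact coeFn_sum_smul _ a fun k => (T ^ e k) f
  rw [← eLpNorm_congr_ae hSf, eLpNorm_ofReal_eq hp0, eLpNorm_ofReal_eq hp0]
  refine (ENNReal.rpow_le_rpow key (by positivity)).trans_eq ?_
  rw [ENNReal.mul_rpow_of_nonneg _ _ (by positivity), ENNReal.ofReal_rpow_of_nonneg (by positivity)
    (by positivity)]
  congr 2
  rw [interpWeight, Real.mul_rpow hC0.le hn0.le, Real.mul_rpow hK0.le hGn.le,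
    show 4 * (C ^ (2 - p) * (n : ℝ) ^ (2 - p) * (K ^ (2 * (p - 1)) * G n ^ (2 * (p - 1))))
      = 4 * (C ^ (2 - p) * K ^ (2 * (p - 1))) * (G n ^ (2 * (p - 1)) * (n : ℝ) ^ (2 - p)) by ring,
    Real.mul_rpow (by positivity) (by positivity),
    Real.mul_rpow (x := G n ^ (2 * (p - 1))) (by positivity) (by positivity),
    ← Real.rpow_mul hGn.le, ← Real.rpow_mul hn0.le, mul_one_div, mul_one_div]

theorem ae_tendsto_and_memLp_iSup_of_isDunfordSchwartz [IsFiniteMeasure μ] {G : ℕ → ℝ}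
    (hG : IsWeight G) {e : ℕ → ℕ} {a : ℕ → ℂ} {C K : ℝ} (hC0 : 0 < C)
    (ha : ∀ k, 1 ≤ k → ‖a k‖ ≤ C) (hK0 : 0 < K)
    (hK : ∀ n, 1 ≤ n → ∀ z : ℂ, ‖z‖ = 1 →
      ‖((G n : ℂ))⁻¹ * ∑ k ∈ Finset.Icc 1 n, a k * z ^ e k‖ ≤ K)
    {p : ℝ} (hp : 1 < p) (hp2 : p < 2)
    {T : Lp H 1 μ →L[ℂ] Lp H 1 μ} (hT : IsDunfordSchwartz μ T) {f : Lp H 1 μ}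
    (hf : MemLp f (ENNReal.ofReal p) μ) {W : ℕ → ℝ} (hW : W ∈ Admissible p (interpWeight p G))
    (hV : SummableVariation (interpWeight p G) W) :
    (∀ᵐ x ∂μ, ∃ s : H, Tendsto (fun n => hilbertSum a e W T f n x) atTop (𝓝 s)) ∧
      MemLp (fun x => ⨆ n : ℕ, ‖hilbertSum a e W T f n x‖ₑ) (ENNReal.ofReal p) μ := by
  simp_rw [hilbertSum_eq]
  set N : ℝ := (eLpNorm f (ENNReal.ofReal p) μ).toReal with hN
  have hNe : eLpNorm f (ENNReal.ofReal p) μ = ENNReal.ofReal N :=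
    (ENNReal.ofReal_toReal hf.2.ne).symm
  have hN0 : 0 ≤ N := ENNReal.toReal_nonneg
  have hF : ∀ n, 1 ≤ n → 0 ≤ interpWeight p G n := fun n hn => by
    have : 0 ≤ G n := zero_le_one.trans (hG.one_le hn)
    unfold interpWeight
    positivity
  set D : ℝ := (4 * (C ^ (2 - p) * K ^ (2 * (p - 1)))) ^ (1 / p) with hD
  have hD0 : 0 ≤ D := by positivity
  refine ae_tendsto_and_memLp_iSup (C := C * N) (K := D * N) hp.le
    (g := fun k x => a k • ((T ^ e k) f : Lp H 1 μ) x)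
    (fun k => (Lp.aestronglyMeasurable _).const_smul _) (by positivity) (by positivity)
    hF (fun k hk => ?_) (fun n hn => ?_) hW hV
  · refine (eLpNorm_const_smul_le (c := a k) (f := ((T ^ e k) f : Lp H 1 μ))).trans ?_
    rw [ENNReal.ofReal_mul hC0.le, ← ofReal_norm, ← hNe]
    exact mul_le_mul' (ENNReal.ofReal_le_ofReal (ha k hk))
      (eLpNorm_pow_le_of_isDunfordSchwartz hT f hp _)
  · refine (eLpNorm_sum_smul_pow_le hG hC0 ha hK0 hK hp hp2 hT f hn).trans_eq ?_
    rw [hNe, ← ENNReal.ofReal_mul (mul_nonneg hD0 (hF n hn))]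
    congr 1
    ring

end Operators

end ErgodicHilbert

theorem theorem4p4
    {Ω : Type*} [MeasurableSpace Ω] (μ : Measure Ω) [IsProbabilityMeasure μ]
    {H : Type*} [NormedAddCommGroup H] [InnerProductSpace ℂ H] [CompleteSpace H]
    (G : ℕ → ℝ) (hG : ErgodicHilbert.IsWeight G)
    (e : ℕ → ℕ) (he : MonotoneOn e (Set.Ici 1))
    (a : ℕ → ℂ) (ha : ∃ C : ℝ, ∀ k, 1 ≤ k → ‖a k‖ ≤ C)
    (hK : ∃ K : ℝ, ∀ n, 1 ≤ n → ∀ z : ℂ, ‖z‖ = 1 →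
      ‖((G n : ℂ))⁻¹ * ∑ k ∈ Finset.Icc 1 n, a k * z ^ e k‖ ≤ K) :
    (∀ T : Lp H 2 μ →L[ℂ] Lp H 2 μ, ‖T‖ ≤ 1 → ∀ f : Lp H 2 μ,
      ∀ W ∈ ErgodicHilbert.Admissible 2 G, ErgodicHilbert.SummableVariation G W →
        (∀ᵐ x ∂μ, ∃ s : H,
          Tendsto (fun n => ErgodicHilbert.hilbertSum a e W T f n x) atTop (𝓝 s)) ∧
        MemLp (fun x => ⨆ n : ℕ, ‖ErgodicHilbert.hilbertSum a e W T f n x‖ₑ) 2 μ) ∧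
    (∀ p : ℝ, 1 < p → p < 2 →
      ∀ T : Lp H 1 μ →L[ℂ] Lp H 1 μ, ErgodicHilbert.IsDunfordSchwartz μ T →
      ∀ f : Lp H 1 μ, MemLp f (ENNReal.ofReal p) μ →
      ∀ W ∈ ErgodicHilbert.Admissible p (ErgodicHilbert.interpWeight p G),
        ErgodicHilbert.SummableVariation (ErgodicHilbert.interpWeight p G) W →
        (∀ᵐ x ∂μ, ∃ s : H,
          Tendsto (fun n => ErgodicHilbert.hilbertSum a e W T f n x) atTop (𝓝 s)) ∧
        MemLp (fun x => ⨆ n : ℕ, ‖ErgodicHilbert.hilbertSum a e W T f n x‖ₑ)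
          (ENNReal.ofReal p) μ) := by
  obtain ⟨C, hC⟩ := ha
  obtain ⟨K, hK⟩ := hK
  -- Both bounds are enlarged to be positive, as interpolation requires of its endpoint constants.
  have hC' : ∀ k, 1 ≤ k → ‖a k‖ ≤ max C 1 := fun k hk => (hC k hk).trans (le_max_left _ _)
  have hK' : ∀ n, 1 ≤ n → ∀ z : ℂ, ‖z‖ = 1 →
      ‖((G n : ℂ))⁻¹ * ∑ k ∈ Finset.Icc 1 n, a k * z ^ e k‖ ≤ max K 1 := fun n hn z hz =>
    (hK n hn z hz).trans (le_max_left _ _)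
  have hC0 : 0 < max C 1 := lt_max_of_lt_right one_pos
  have hK0 : 0 < max K 1 := lt_max_of_lt_right one_pos
  exact ⟨fun T hT f W hW hV =>
      ErgodicHilbert.ae_tendsto_and_memLp_iSup_of_contraction hG hC0.le hC' hK0.le hK' hT f hW hV,
    fun p hp hp2 T hT f hf W hW hV =>
      ErgodicHilbert.ae_tendsto_and_memLp_iSup_of_isDunfordSchwartz hG hC0 hC' hK0 hK' hp hp2 hT hf
        hW hV⟩
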